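/- Let $\mathfrak g^\sigma$ be a finite-dimensional real semisimple Lie algebra, $\mathfrak g=\mathbb C\otimes_{\mathbb R}\mathfrak g^\sigma$ its complexification and $\sigma$ the conjugation of $\mathfrak g$ with respect to $\mathfrak g^\sigma$. Let $\mathfrak h^\sigma$ be a Cartan subalgebra of $\mathfrak g^\sigma$, $\mathfrak h$ its complexification, $\mathcal R$ the root system of $(\mathfrak g,\mathfrak h)$ with root spaces $\mathfrak g_\beta$, and let $\sigma$ also denote the induced symmetry of roots, $\sigma(\alpha)(H)=\overline{\alpha(\sigma(H))}$. Put $\mathcal R^\sigma_\bullet=\{\alpha\in\mathcal R\mid\sigma(\alpha)=-\alpha\}$ (the imaginary roots). Let $\mathcal B$ be a base of simple roots of $\mathcal R$, write $\beta=\sum_{\alpha\in\mathcal B}n_{\beta,\alpha}\alpha$ for $\beta\in\mathcal R$, and for $\phi\subseteq\mathcal B$ put $$\mathcal Q_\phi=\{\beta\in\mathcal R\mid n_{\beta,\alpha}\ge 0\ \ \forall\alpha\in\phi\},\qquad \mathfrak q_\phi=\mathfrak h\oplus\sum_{\beta\in\mathcal Q_\phi}\mathfrak g_\beta ,$$ $$\mathcal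 Q^r_\phi=\{\beta\in\mathcal Q_\phi\mid-\beta\in\mathcal Q_\phi\},\quad \mathcal Q^n_\phi=\{\beta\in\mathcal Q_\phi\mid-\beta\notin\mathcal Q_\phi\},\quad \mathcal Q^{-n}_\phi=\{\beta\mid-\beta\in\mathcal Q^n_\phi\}.$$ A real Lie subalgebra $\mathfrak t$ of $\mathfrak g^\sigma$ is *triangular* if in some basis of $\mathfrak g^\sigma$ all the maps $\mathrm{ad}(X)$, $X\in\mathfrak t$, have upper triangular matrices. The CR algebra $(\mathfrak g^\sigma,\mathfrak q_\phi)$ is *minimal* (the CR algebra of a minimal, i.e. closed, orbit) if $\mathfrak q_\phi\cap\mathfrak g^\sigma$ contains a maximal triangular subalgebra of $\mathfrak g^\sigma$. For a CR algebra $(\mathfrak g^\sigma,\mathfrak q)$ put $\mathfrak q^{(0)}=\mathfrak q$ and $\mathfrak q^{(k)}=\{Z\in\mathfrak q^{(k-1)}\mid[Z,\sigma(\mathfrak q)]\subseteq\mathfrak q^{(k-1)}+\sigma(\mathfrak q)\}$ for $k\ge1$. It is *finitely nondegenerate*, of *Levi order* $k$, if $k$ is a positive integer with $\mathfrak q^{(k-1)}\supsetneq\mathfrak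 q^{(k)}=\mathfrak q\cap\sigma(\mathfrak q)$; such a $k$ is unique. For $\beta\in\mathcal Q_\phi\cap\sigma(\mathcal Q_\phi^{-n})$ let $k^\sigma_\phi(\beta)\in\{1,2,\dots\}\cup\{+\infty\}$ be the smallest positive integer $k$ for which there are $\alpha_1,\dots,\alpha_k\in\sigma(\mathcal Q_\phi)$ with $\beta+\sum_{i\le h}\alpha_i\in\mathcal R$ for all $1\le h\le k$ and $\beta+\sum_{i\le k}\alpha_i\in\mathcal Q_\phi^{-n}\cap\sigma(\mathcal Q_\phi^{-n})$, and $+\infty$ if there is none. **Proposition.** Suppose that $(\mathfrak g^\sigma,\mathfrak q_\phi)$ is minimal. Then $$\mathcal Q_\phi\cap\sigma(\mathcal Q_\phi^{-n})=(\mathcal Q^n_\phi\cap\mathcal R^\sigma_\bullet)\cup(\mathcal Q^r_\phi\cap\sigma(\mathcal Q_\phi^{-n})).$$ If moreover $(\mathfrak g^\sigma,\mathfrak q_\phi)$ is finitely nondegenerate, then its Levi order is $1$ if $\mathcal Q^n_\phi\cap\mathcal R^\sigma_\bullet=\emptyset$, and it is $\sup\{k^\sigma_\phi(\beta)\mid\beta\in\mathcal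 Q^n_\phi\cap\mathcal R^\sigma_\bullet\}$ if $\mathcal Q^n_\phi\cap\mathcal R^\sigma_\bullet\ne\emptyset$. -/

import Mathlib

open Module
open scoped TensorProduct

noncomputable section

namespace CRAlg

/-! ### Complexification of a real Lie algebra -/

section Complexification

variable (𝔤 : Type*) [LieRing 𝔤] [LieAlgebra ℝ 𝔤]

/-- The conjugation `σ` of `ℂ ⊗ 𝔤` with respect to its real form `𝔤`,
`σ (z ⊗ x) = conj z ⊗ x`, as a conjugate-linear map. -/
def conj : (ℂ ⊗[ℝ] 𝔤) →ₛₗ[starRingEnd ℂ] (ℂ ⊗[ℝ] 𝔤) where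
  toFun := TensorProduct.map Complex.conjAe.toLinearMap (LinearMap.id : 𝔤 →ₗ[ℝ] 𝔤)
  map_add' x y := map_add _ x y
  map_smul' c x := by
    induction x with
    | zero => simp
    | tmul z x => simp [TensorProduct.smul_tmul']
    | add x y hx hy => simp only [smul_add, map_add, hx, hy]

@[simp]
theorem conj_tmul (z : ℂ) (x : 𝔤) :
    conj 𝔤 (z ⊗ₜ[ℝ] x) = (starRingEnd ℂ z) ⊗ₜ[ℝ] x := rfl

/-- Every element of `ℂ ⊗ 𝔤` is `x + i y` with `x`, `y` in `𝔤`. -/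
theorem exists_re_im (z : ℂ ⊗[ℝ] 𝔤) :
    ∃ x y : 𝔤, z = (1 : ℂ) ⊗ₜ[ℝ] x + Complex.I ⊗ₜ[ℝ] y := by
  induction z with
  | zero => exact ⟨0, 0, by simp⟩
  | tmul c x =>
    refine ⟨c.re • x, c.im • x, ?_⟩
    rw [TensorProduct.tmul_smul, TensorProduct.tmul_smul, TensorProduct.smul_tmul',
      TensorProduct.smul_tmul', ← TensorProduct.add_tmul]
    congr 1
    apply Complex.ext <;> simp
  | add a b ha hb =>
    obtain ⟨x, y, rfl⟩ := ha
    obtain ⟨x', y', rfl⟩ := hb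
    exact ⟨x + x', y + y', by simp only [TensorProduct.tmul_add]; abel⟩

/-- An element `x + i y` lies in the complexification of a real subspace only if `x`, `y`
lie in that subspace. -/
theorem mem_of_mem_baseChange (p : Submodule ℝ 𝔤) (x y : 𝔤)
    (h : (1 : ℂ) ⊗ₜ[ℝ] x + Complex.I ⊗ₜ[ℝ] y ∈ p.baseChange ℂ) : x ∈ p ∧ y ∈ p := by
  have key : ∀ (f : ℂ →ₗ[ℝ] ℝ) (z : ℂ ⊗[ℝ] 𝔤), z ∈ p.baseChange ℂ →
      TensorProduct.lid ℝ 𝔤 (LinearMap.rTensor 𝔤 f z) ∈ p := by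
    intro f z hz
    rw [Submodule.baseChange_eq_span] at hz
    induction hz using Submodule.span_induction generalizing f with
    | mem z hz =>
      obtain ⟨m, hm, rfl⟩ := hz
      simpa using p.smul_mem _ hm
    | zero => simp
    | add a b _ _ ha hb => simpa using p.add_mem (ha f) (hb f)
    | smul c z _ ih =>
      have := ih (f ∘ₗ LinearMap.mulLeft ℝ c)
      convert this using 2
      clear this ih
      rename_i hz
      clear hz
      induction z with
      | zero => simp
      | tmul a m => simp [TensorProduct.smul_tmul']
      | add a b ha hb => simp only [smul_add, map_add, ha, hb]
  constructor
  · simpa using key Complex.reLm _ h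
  · simpa using key Complex.imLm _ h

variable {𝔤}

/-- The complexification `ℂ ⊗ 𝔥` of a real Lie subalgebra `𝔥`, inside `ℂ ⊗ 𝔤`. -/
def complexify (𝔥 : LieSubalgebra ℝ 𝔤) : LieSubalgebra ℂ (ℂ ⊗[ℝ] 𝔤) where
  __ := 𝔥.toSubmodule.baseChange ℂ
  lie_mem' := by
    intro x y hx hy
    change x ∈ 𝔥.toSubmodule.baseChange ℂ at hx
    change y ∈ 𝔥.toSubmodule.baseChange ℂ at hy
    change ⁅x, y⁆ ∈ 𝔥.toSubmodule.baseChange ℂ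
    rw [Submodule.baseChange_eq_span] at hx hy
    induction hx, hy using Submodule.span_induction₂ with
    | mem_mem x y hx hy =>
      obtain ⟨a, ha, rfl⟩ := hx
      obtain ⟨b, hb, rfl⟩ := hy
      simpa using Submodule.tmul_mem_baseChange_of_mem (1 : ℂ) (𝔥.lie_mem ha hb)
    | zero_left y hy => simp
    | zero_right x hx => rw [← lie_skew]; simp
    | add_left x y z _ _ _ h₁ h₂ => rw [LieRing.add_lie]; exact add_mem h₁ h₂
    | add_right x y z _ _ _ h₁ h₂ => rw [LieRing.lie_add]; exact add_mem h₁ h₂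
    | smul_left r x y _ _ h => rw [smul_lie]; exact Submodule.smul_mem _ r h
    | smul_right r x y _ _ h => rw [LieAlgebra.lie_smul]; exact Submodule.smul_mem _ r h

theorem mem_complexify {𝔥 : LieSubalgebra ℝ 𝔤} {z : ℂ ⊗[ℝ] 𝔤} :
    z ∈ complexify 𝔥 ↔ z ∈ 𝔥.toSubmodule.baseChange ℂ := Iff.rfl

theorem tmul_mem_complexify {𝔥 : LieSubalgebra ℝ 𝔤} (c : ℂ) {x : 𝔤} (hx : x ∈ 𝔥) :
    c ⊗ₜ[ℝ] x ∈ complexify 𝔥 :=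
  Submodule.tmul_mem_baseChange_of_mem (p := 𝔥.toSubmodule) c hx

theorem conj_mem_complexify {𝔥 : LieSubalgebra ℝ 𝔤} {z : ℂ ⊗[ℝ] 𝔤} (hz : z ∈ complexify 𝔥) :
    conj 𝔤 z ∈ complexify 𝔥 := by
  obtain ⟨x, y, rfl⟩ := exists_re_im 𝔤 z
  obtain ⟨hx, hy⟩ := mem_of_mem_baseChange 𝔤 _ x y hz
  rw [map_add, conj_tmul, conj_tmul]
  exact add_mem (tmul_mem_complexify _ hx) (tmul_mem_complexify _ hy)

instance instIsKilling [FiniteDimensional ℝ 𝔤] [LieAlgebra.IsKilling ℝ 𝔤] :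
    LieAlgebra.IsKilling ℂ (ℂ ⊗[ℝ] 𝔤) where
  killingCompl_top_eq_bot := by
    rw [eq_bot_iff]
    intro z hz
    rw [LieIdeal.mem_killingCompl] at hz
    obtain ⟨x, y, rfl⟩ := exists_re_im 𝔤 z
    have key : ∀ w : 𝔤, killingForm ℝ 𝔤 w x = 0 ∧ killingForm ℝ 𝔤 w y = 0 := by
      intro w
      have h : LieModule.traceForm ℂ (ℂ ⊗[ℝ] 𝔤) (ℂ ⊗[ℝ] 𝔤) ((1 : ℂ) ⊗ₜ[ℝ] w)
          ((1 : ℂ) ⊗ₜ[ℝ] x + Complex.I ⊗ₜ[ℝ] y) = 0 :=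
        hz ((1 : ℂ) ⊗ₜ[ℝ] w) (LieSubmodule.mem_top _)
      rw [LieModule.traceForm_baseChange] at h
      simp only [map_add, LinearMap.BilinForm.baseChange_tmul] at h
      have h1 := congrArg Complex.re h
      have h2 := congrArg Complex.im h
      simp at h1 h2
      exact ⟨h1, h2⟩
    have hx : x = 0 := by
      have : x ∈ LieIdeal.killingCompl ℝ 𝔤 ⊤ := by
        rw [LieIdeal.mem_killingCompl]; exact fun w _ => (key w).1
      simpa using this
    have hy : y = 0 := by
      have : y ∈ LieIdeal.killingCompl ℝ 𝔤 ⊤ := by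
        rw [LieIdeal.mem_killingCompl]; exact fun w _ => (key w).2
      simpa using this
    simp [hx, hy]

instance instIsCartan (𝔥 : LieSubalgebra ℝ 𝔤) [h𝔥 : 𝔥.IsCartanSubalgebra] :
    (complexify 𝔥).IsCartanSubalgebra where
  nilpotent := by
    let f : (ℂ ⊗[ℝ] 𝔥) →ₗ⁅ℂ⁆ (ℂ ⊗[ℝ] 𝔤) :=
      { LinearMap.baseChange ℂ (𝔥.subtype : 𝔥 →ₗ[ℝ] 𝔤) with
        map_lie' := fun {x y} =>
          (LieAlgebra.ExtendScalars.map (AlgHom.id ℝ ℂ) 𝔥.incl).map_lie x y }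
    have hf : f.range = complexify 𝔥 := by
      ext z
      rw [LieHom.mem_range]
      constructor
      · rintro ⟨w, rfl⟩
        obtain ⟨x, y, rfl⟩ := exists_re_im 𝔥 w
        rw [map_add]
        exact add_mem (tmul_mem_complexify (1 : ℂ) x.2) (tmul_mem_complexify Complex.I y.2)
      · intro hz
        obtain ⟨x, y, rfl⟩ := exists_re_im 𝔤 z
        obtain ⟨hx, hy⟩ := mem_of_mem_baseChange 𝔤 _ x y hz
        exact ⟨(1 : ℂ) ⊗ₜ[ℝ] (⟨x, hx⟩ : 𝔥) + Complex.I ⊗ₜ[ℝ] (⟨y, hy⟩ : 𝔥), map_add f _ _⟩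
    have : LieRing.IsNilpotent (ℂ ⊗[ℝ] 𝔥) :=
      LieModule.instIsNilpotentTensor ℝ ℂ 𝔥 𝔥
    rw [← hf]
    exact f.isNilpotent_range
  self_normalizing := by
    refine le_antisymm (fun z hz => ?_) (LieSubalgebra.le_normalizer _)
    obtain ⟨x, y, rfl⟩ := exists_re_im 𝔤 z
    rw [LieSubalgebra.mem_normalizer_iff] at hz
    have key : ∀ w ∈ 𝔥, ⁅x, w⁆ ∈ 𝔥 ∧ ⁅y, w⁆ ∈ 𝔥 := by
      intro w hw
      have h := hz ((1 : ℂ) ⊗ₜ[ℝ] w) (tmul_mem_complexify 1 hw)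
      rw [add_lie, LieAlgebra.ExtendScalars.bracket_tmul, LieAlgebra.ExtendScalars.bracket_tmul,
        mul_one, mul_one] at h
      exact mem_of_mem_baseChange 𝔤 _ _ _ h
    have hx : x ∈ 𝔥 := by
      rw [← h𝔥.self_normalizing, LieSubalgebra.mem_normalizer_iff]
      exact fun w hw => (key w hw).1
    have hy : y ∈ 𝔥 := by
      rw [← h𝔥.self_normalizing, LieSubalgebra.mem_normalizer_iff]
      exact fun w hw => (key w hw).2
    exact add_mem (tmul_mem_complexify _ hx) (tmul_mem_complexify _ hy)

end Complexification

/-! ### CR algebras -/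

section CRAlgebra

variable {𝔤 : Type*} [LieRing 𝔤] [LieAlgebra ℝ 𝔤]

/-- The isotropy subalgebra `𝔤 ∩ 𝔮` of the CR algebra `(𝔤, 𝔮)`. -/
def isotropy (𝔮 : LieSubalgebra ℂ (ℂ ⊗[ℝ] 𝔤)) : LieSubalgebra ℝ 𝔤 where
  carrier := {x | (1 : ℂ) ⊗ₜ[ℝ] x ∈ 𝔮}
  add_mem' {x y} hx hy := by
    simp only [Set.mem_ofPred_eq, TensorProduct.tmul_add] at *; exact add_mem hx hy
  zero_mem' := by simp
  smul_mem' c x hx := by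
    have h := 𝔮.smul_mem (c : ℂ) hx
    rw [TensorProduct.smul_tmul', smul_eq_mul, mul_one] at h
    have e : (1 : ℂ) ⊗ₜ[ℝ] (c • x) = (c : ℂ) ⊗ₜ[ℝ] x := by
      rw [TensorProduct.tmul_smul, TensorProduct.smul_tmul', Complex.real_smul, mul_one]
    change (1 : ℂ) ⊗ₜ[ℝ] (c • x) ∈ 𝔮
    rwa [e]
  lie_mem' {x y} hx hy := by
    have h := 𝔮.lie_mem hx hy
    rwa [LieAlgebra.ExtendScalars.bracket_tmul, mul_one] at h

/-- A real Lie subalgebra `𝔱` of `𝔤` is triangular if, in a suitable basis of `𝔤`, all `ad X`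
with `X ∈ 𝔱` are represented by upper triangular matrices. -/
def IsTriangular (𝔱 : LieSubalgebra ℝ 𝔤) : Prop :=
  ∃ (n : ℕ) (e : Basis (Fin n) ℝ 𝔤), ∀ X ∈ 𝔱,
    (LinearMap.toMatrix e e (LieAlgebra.ad ℝ 𝔤 X)).BlockTriangular id

/-- The CR algebra `(𝔤, 𝔮)` is minimal: its isotropy subalgebra contains a maximal triangular
subalgebra of `𝔤`. -/
def IsMinimal (𝔮 : LieSubalgebra ℂ (ℂ ⊗[ℝ] 𝔤)) : Prop :=
  ∃ 𝔱 : LieSubalgebra ℝ 𝔤, Maximal IsTriangular 𝔱 ∧ 𝔱 ≤ isotropy 𝔮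

/-- The subspace `σ(𝔮)`. -/
def conjSubmodule (𝔮 : LieSubalgebra ℂ (ℂ ⊗[ℝ] 𝔤)) : Submodule ℂ (ℂ ⊗[ℝ] 𝔤) :=
  𝔮.toSubmodule.map (conj 𝔤)

/-- The descending chain `𝔮⁽⁰⁾ = 𝔮`,
`𝔮⁽ᵏ⁺¹⁾ = {Z ∈ 𝔮⁽ᵏ⁾ | [Z, σ(𝔮)] ⊆ 𝔮⁽ᵏ⁾ + σ(𝔮)}`. -/
def freeman (𝔮 : LieSubalgebra ℂ (ℂ ⊗[ℝ] 𝔤)) : ℕ → Submodule ℂ (ℂ ⊗[ℝ] 𝔤)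
  | 0 => 𝔮.toSubmodule
  | k + 1 =>
    { carrier := {Z | Z ∈ freeman 𝔮 k ∧
        ∀ W ∈ conjSubmodule 𝔮, ⁅Z, W⁆ ∈ freeman 𝔮 k ⊔ conjSubmodule 𝔮}
      add_mem' := fun {a b} ha hb => ⟨add_mem ha.1 hb.1, fun W hW => by
        rw [LieRing.add_lie]; exact add_mem (ha.2 W hW) (hb.2 W hW)⟩
      zero_mem' := ⟨zero_mem _, fun W _ => by rw [zero_lie]; exact zero_mem _⟩
      smul_mem' := fun c a ha => ⟨Submodule.smul_mem _ c ha.1, fun W hW => by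
        rw [smul_lie]; exact Submodule.smul_mem _ c (ha.2 W hW)⟩ }

/-- `(𝔤, 𝔮)` is `k`-nondegenerate: `𝔮⁽ᵏ⁻¹⁾ ⊋ 𝔮⁽ᵏ⁾ = 𝔮 ∩ σ(𝔮)`, with `k` a positive integer. -/
def IsNondegenerateOfOrder (𝔮 : LieSubalgebra ℂ (ℂ ⊗[ℝ] 𝔤)) (k : ℕ) : Prop :=
  1 ≤ k ∧ freeman 𝔮 k < freeman 𝔮 (k - 1) ∧ freeman 𝔮 k = 𝔮.toSubmodule ⊓ conjSubmodule 𝔮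

/-- `(𝔤, 𝔮)` is finitely nondegenerate: it is `k`-nondegenerate for some positive integer `k`. -/
def IsFinitelyNondegenerate (𝔮 : LieSubalgebra ℂ (ℂ ⊗[ℝ] 𝔤)) : Prop :=
  ∃ k, IsNondegenerateOfOrder 𝔮 k

/-- The Levi order of `(𝔤, 𝔮)`: the (unique) `k` for which it is `k`-nondegenerate, and `∞` if
there is none. -/
def leviOrder (𝔮 : LieSubalgebra ℂ (ℂ ⊗[ℝ] 𝔤)) : ℕ∞ :=
  ⨅ (k : ℕ) (_ : IsNondegenerateOfOrder 𝔮 k), (k : ℕ∞)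

end CRAlgebra

/-! ### Roots and parabolic CR algebras -/

section Roots

variable {𝔤 : Type*} [LieRing 𝔤] [LieAlgebra ℝ 𝔤] (𝔥 : LieSubalgebra ℝ 𝔤)

/-- The dual of the complexification `ℂ ⊗ 𝔥` of `𝔥`. -/
abbrev CartanDual : Type _ := Dual ℂ (complexify 𝔥)

/-- The symmetry induced by the conjugation on linear functionals on `ℂ ⊗ 𝔥`:
`σ(α)(H) = conj (α (σ H))`, so that `σ` maps the root space of `α` onto that of `σ(α)`. -/
def conjDual (α : CartanDual 𝔥) : CartanDual 𝔥 where
  toFun H := starRingEnd ℂ (α ⟨conj 𝔤 H, conj_mem_complexify H.2⟩)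
  map_add' x y := by
    rw [← map_add, ← map_add]
    congr 2
    exact Subtype.ext (map_add (conj 𝔤) _ _)
  map_smul' c x := by
    have h : (⟨conj 𝔤 (c • x : complexify 𝔥), conj_mem_complexify (c • x).2⟩ : complexify 𝔥) =
        starRingEnd ℂ c • ⟨conj 𝔤 x, conj_mem_complexify x.2⟩ :=
      Subtype.ext ((conj 𝔤).map_smulₛₗ c (x : ℂ ⊗[ℝ] 𝔤))
    rw [h, map_smul, smul_eq_mul, map_mul, RingHomCompTriple.comp_apply]
    rfl

variable [FiniteDimensional ℝ 𝔤] [LieAlgebra.IsSemisimple ℝ 𝔤] [𝔥.IsCartanSubalgebra]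

/-- The root system of `ℂ ⊗ 𝔤` with respect to `ℂ ⊗ 𝔥`. -/
abbrev rootSys : RootPairing (complexify 𝔥).root ℂ (CartanDual 𝔥) (complexify 𝔥) :=
  LieAlgebra.IsKilling.rootSystem (complexify 𝔥)

/-- The set of roots. -/
def roots : Set (CartanDual 𝔥) := Set.range (rootSys 𝔥).root

/-- The set of imaginary roots, `σ(α) = -α`. -/
def imaginaryRoots : Set (CartanDual 𝔥) := {α ∈ roots 𝔥 | conjDual 𝔥 α = -α}

variable {𝔥} (b : (rootSys 𝔥).Base) (φ : Set b.support)

/-- The coefficient `n_{β,α}` of the simple root `α` in the root `β`. -/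
def coeff (β : (complexify 𝔥).root) (α : b.support) : ℤ :=
  b.toWeightBasisInt.repr ((rootSys 𝔥).rootSpanMem ℤ β) α

/-- The parabolic set `Q_φ` of the roots `β` with `n_{β,α} ≥ 0` for all `α ∈ φ`. -/
def Q : Set (CartanDual 𝔥) :=
  {β | ∃ i, (rootSys 𝔥).root i = β ∧ ∀ α ∈ φ, 0 ≤ coeff b i α}

/-- `Q_φ^r = {β ∈ Q_φ | -β ∈ Q_φ}`. -/
def Qr : Set (CartanDual 𝔥) := {β ∈ Q b φ | -β ∈ Q b φ}

/-- `Q_φ^n = {β ∈ Q_φ | -β ∉ Q_φ}`. -/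
def Qn : Set (CartanDual 𝔥) := {β ∈ Q b φ | -β ∉ Q b φ}

/-- `Q_φ^{-n} = {β | -β ∈ Q_φ^n}`. -/
def Qneg : Set (CartanDual 𝔥) := {β | -β ∈ Qn b φ}

/-- The parabolic subspace `(ℂ ⊗ 𝔥) ⊕ ∑_{β ∈ Q_φ} 𝔤_β`. -/
def parabolicSubmodule : Submodule ℂ (ℂ ⊗[ℝ] 𝔤) :=
  (complexify 𝔥).toSubmodule ⊔
    ⨆ β ∈ Q b φ, (LieAlgebra.rootSpace (complexify 𝔥) β).toSubmodule

/-- The functionals that are integral combinations of roots, with coefficients `≥ 0` at `φ`. -/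
def nonnegCombinations : Set (complexify 𝔥 → ℂ) :=
  {χ | ∃ x : (rootSys 𝔥).rootSpan ℤ, ((x : CartanDual 𝔥) : complexify 𝔥 → ℂ) = χ ∧
    ∀ α ∈ φ, 0 ≤ b.toWeightBasisInt.repr x α}

theorem parabolicSubmodule_eq : parabolicSubmodule b φ =
    (⨆ χ, ⨆ (_ : χ ∈ nonnegCombinations b φ),
      LieAlgebra.rootSpace (complexify 𝔥) χ).toSubmodule := by
  simp only [LieSubmodule.iSup_toSubmodule]
  have h0 : (complexify 𝔥).toSubmodule =
      (LieAlgebra.rootSpace (complexify 𝔥) (0 : complexify 𝔥 → ℂ)).toSubmodule := by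
    rw [LieAlgebra.rootSpace_zero_eq]; rfl
  apply le_antisymm
  · refine sup_le ?_ (iSup₂_le ?_)
    · rw [h0]
      exact le_iSup₂_of_le 0 ⟨0, rfl, fun α _ => by
        rw [LinearEquiv.map_zero]; exact le_rfl⟩ le_rfl
    · rintro _ ⟨i, rfl, hi⟩
      exact le_iSup₂_of_le _ ⟨(rootSys 𝔥).rootSpanMem ℤ i, rfl, hi⟩ le_rfl
  · refine iSup₂_le ?_
    rintro χ ⟨x, rfl, hx⟩
    by_cases hbot : LieAlgebra.rootSpace (complexify 𝔥) ((x : CartanDual 𝔥) : complexify 𝔥 → ℂ) = ⊥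
    · rw [hbot]; simp
    by_cases hz : (x : CartanDual 𝔥) = 0
    · refine le_sup_of_le_left ?_
      rw [h0, hz]; rfl
    · refine le_sup_of_le_right ?_
      let w : LieModule.Weight ℂ (complexify 𝔥) (ℂ ⊗[ℝ] 𝔤) := ⟨_, hbot⟩
      have hw : w ∈ (complexify 𝔥).root := by
        rw [Finset.mem_filter]
        refine ⟨Finset.mem_univ _, fun h => hz ?_⟩
        exact LinearMap.ext fun t => congrFun h t
      have hr : (rootSys 𝔥).root ⟨w, hw⟩ = (x : CartanDual 𝔥) := LinearMap.ext fun t => rfl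
      refine le_iSup₂_of_le (x : CartanDual 𝔥) ⟨⟨w, hw⟩, hr, ?_⟩ le_rfl
      have : (rootSys 𝔥).rootSpanMem ℤ ⟨w, hw⟩ = x := Subtype.ext hr
      intro α hα
      rw [coeff, this]
      exact hx α hα

theorem parabolicSubmodule_lie_mem {x y : ℂ ⊗[ℝ] 𝔤} (hx : x ∈ parabolicSubmodule b φ)
    (hy : y ∈ parabolicSubmodule b φ) : ⁅x, y⁆ ∈ parabolicSubmodule b φ := by
  rw [parabolicSubmodule_eq] at *
  refine LieAlgebra.mem_biSup_genWeightSpace_of ?_ hx hy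
  rintro _ ⟨x, rfl, hx⟩ _ ⟨y, rfl, hy⟩
  refine ⟨x + y, rfl, fun α hα => ?_⟩
  rw [map_add]
  exact add_nonneg (hx α hα) (hy α hα)

/-- The parabolic subalgebra `𝔮_φ = (ℂ ⊗ 𝔥) ⊕ ∑_{β ∈ Q_φ} 𝔤_β` of `ℂ ⊗ 𝔤`. -/
def parabolic : LieSubalgebra ℂ (ℂ ⊗[ℝ] 𝔤) where
  __ := parabolicSubmodule b φ
  lie_mem' := parabolicSubmodule_lie_mem b φ

/-- The condition on `k` in the definition of `k_φ^σ(β)`: there are `α₀, …, α_{k-1} ∈ σ(Q_φ)` such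
that the partial sums `β + α₀ + ⋯ + α_{h-1}`, `1 ≤ h ≤ k`, are all roots, the last one in
`Q_φ^{-n} ∩ σ(Q_φ^{-n})`. -/
def HasEscape (β : CartanDual 𝔥) (k : ℕ) : Prop :=
  ∃ α : ℕ → CartanDual 𝔥, (∀ i < k, α i ∈ conjDual 𝔥 '' Q b φ) ∧
    (∀ h, 1 ≤ h → h ≤ k → β + ∑ i ∈ Finset.range h, α i ∈ roots 𝔥) ∧
    β + ∑ i ∈ Finset.range k, α i ∈ Qneg b φ ∩ conjDual 𝔥 '' Qneg b φ

/-- `k_φ^σ(β)`: the smallest positive integer `k` satisfying `HasEscape`, `∞` if there is none. -/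
def kIndex (β : CartanDual 𝔥) : ℕ∞ :=
  ⨅ (k : ℕ) (_ : 1 ≤ k ∧ HasEscape b φ β k), (k : ℕ∞)

end Roots

end CRAlg

end

/-! Write 𝔮 for the parabolic subalgebra, Q for its set of roots and 𝔦 for its isotropy. The main
point is that, when 𝔦 contains a maximal triangular subalgebra 𝔱, a root β of Q^n with σ(β) outside
Q is imaginary (`conjDual_eq_neg`). If not, some coroot T gives a real element H = T + σ(T) on which
all roots are integers and β(H) ≠ 0; replacing β by -σ(β) if necessary, β(H) > 0. For E in the root
space of -β, the real vector X = E + σ(E) has a negative ad H-eigenvalue, is Killing-orthogonal to 𝔦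
and does not lie in 𝔦. `Triangular.mem_of_killingForm_eq_zero` forbids this.

That lemma is a dimension count. Degenerating 𝔱 along H gives an H-invariant triangular 𝔲 inside 𝔦
of the same dimension, which is the largest possible (`Triangular.finrank_le_of_maximal`); so H lies
in 𝔲 and 𝔲 = 𝔲₋ + 𝔲₀ + 𝔲₊ by sign of the eigenvalue. With P the sum of all positive eigenspaces, 𝔲₀
+ P is triangular, so dim P ≤ dim 𝔲₋ + dim 𝔲₊. But 𝔲₋ + ⟨X⟩ is orthogonal to 𝔲₊ in the perfect
pairing of the negative part with P, so X outside 𝔲₋ would violate this bound.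

The degenerations are limits of exp(s ad T) U for s → ∞, built algebraically: leading coefficients
for the nilpotent part of ad T, leading eigencomponents for the semisimple part. They play the role
of a fixed point theorem for triangular groups.

For the Levi order, each 𝔮⁽ᵏ⁾ is a sum of 𝔥 and root spaces, and brackets of root spaces are nonzero
whenever the sum is a root. Hence a root outside σ(Q) has left 𝔮⁽ᵏ⁾ exactly when it has an escaping
chain of length at most k (`not_rootSub_le_freeman_iff`). A root of Q^r that survives in 𝔮⁽¹⁾
survives forever (`rootSub_le_freeman_of_mem_Qr`), so by the first part only imaginary roots of Q^n
can push the order beyond 1. -/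

noncomputable section

/-! ### Limits of subspaces under a one-parameter group of unipotent maps -/

namespace UnipotentLimit

variable {K : Type*} [Field K]
variable {V : Type*} [AddCommGroup V] [Module K V]

/-- The derivative of a formal curve, given by its Taylor coefficients. -/
def deriv : (ℕ → V) →ₗ[K] (ℕ → V) where
  toFun u l := ((l : K) + 1) • u (l + 1)
  map_add' u v := by ext l; simp
  map_smul' c u := by ext l; simp [smul_comm c]

@[simp] theorem deriv_apply (u : ℕ → V) (l : ℕ) :
    deriv (K := K) u l = ((l : K) + 1) • u (l + 1) := rfl

/-- The coefficient at `s ^ l` of `exp (s N) u(s)`. -/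
def flow (N : Module.End K V) : ℕ → (ℕ → V) →ₗ[K] V
  | 0 => LinearMap.proj 0
  -- The coefficient at s^l of (exp(sN) u)' = N exp(sN) u + exp(sN) u', solved for the next
  -- coefficient.
  | l + 1 => ((l : K) + 1)⁻¹ • (N ∘ₗ flow N l + flow N l ∘ₗ deriv)

@[simp] theorem flow_zero (N : Module.End K V) (u : ℕ → V) : flow N 0 u = u 0 := rfl

theorem flow_succ (N : Module.End K V) (l : ℕ) (u : ℕ → V) :
    flow N (l + 1) u = ((l : K) + 1)⁻¹ • (N (flow N l u) + flow N l (deriv (K := K) u)) := rfl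

/-- Multiplication of a formal curve by the parameter. -/
def shift (u : ℕ → V) : ℕ → V
  | 0 => 0
  | l + 1 => u l

@[simp] theorem shift_zero (u : ℕ → V) : shift u 0 = 0 := rfl

@[simp] theorem shift_succ (u : ℕ → V) (l : ℕ) : shift u (l + 1) = u l := rfl

/-- Each step of the recursion either applies N once more or differentiates u, lowering its degree
bound m. For nilpotent N this bounds the degree of exp(sN) u when u is polynomial; the truncated
exponent is 0 for l < m. -/
theorem flow_mem_range_pow (N : Module.End K V) (l m : ℕ) (u : ℕ → V) (hu : ∀ j, m ≤ j → u j = 0) :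
    flow N l u ∈ LinearMap.range (N ^ (l + 1 - m)) := by
  induction l generalizing m u with
  | zero =>
    cases m with
    | zero => simp [hu 0 le_rfl]
    | succ m => simp
  | succ l ih =>
    rw [flow_succ]
    refine Submodule.smul_mem _ _ (add_mem ?_ ?_)
    · cases m with
      | zero =>
        have : u = 0 := funext fun j => hu j (Nat.zero_le _)
        simp [this]
      | succ m =>
        obtain ⟨v, hv⟩ := ih (m + 1) u hu
        rw [← hv]
        by_cases hm : m + 1 ≤ l + 1
        · rw [show l + 1 + 1 - (m + 1) = (l + 1 - (m + 1)) + 1 by omega, pow_succ']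
          exact ⟨v, rfl⟩
        · rw [show l + 1 + 1 - (m + 1) = 0 by omega]
          exact ⟨_, rfl⟩
    · cases m with
      | zero =>
        have : u = 0 := funext fun j => hu j (Nat.zero_le _)
        simp [this]
      | succ m =>
        have := ih m (deriv (K := K) u) fun j hj => by simp [hu (j + 1) (by omega)]
        rwa [show l + 1 + 1 - (m + 1) = l + 1 - m by omega]

section CharZero

variable [CharZero K]

theorem smul_flow_succ (N : Module.End K V) (l : ℕ) (u : ℕ → V) :
    ((l : K) + 1) • flow N (l + 1) u = N (flow N l u) + flow N l (deriv (K := K) u) := by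
  rw [flow_succ, smul_inv_smul₀ (Nat.cast_add_one_ne_zero l)]

/-- Multiplication by s commutes with exp(sN), since (s u)' = u + s u'. It lets leading coefficients
at different exponents be moved to a common one. -/
theorem flow_shift (N : Module.End K V) (l : ℕ) (u : ℕ → V) :
    flow N (l + 1) (shift u) = flow N l u ∧ flow N 0 (shift u) = 0 := by
  refine ⟨?_, rfl⟩
  induction l generalizing u with
  | zero =>
    rw [flow_succ]; simp
  | succ l ih =>
    have hd : deriv (K := K) (shift u) = u + shift (deriv (K := K) u) := by
      ext j; cases j with
      | zero => simp
      | succ j => simp; module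
    have h0 : ((l : K) + 1 + 1) ≠ 0 := by
      simpa using Nat.cast_add_one_ne_zero (R := K) (l + 1)
    have h := smul_flow_succ N (l + 1) (shift u)
    rw [hd, map_add, ih, ih] at h
    push_cast at h
    refine smul_right_injective V h0 ?_
    dsimp only
    rw [h, add_left_comm, ← smul_flow_succ]
    module

/-- The derivative of u satisfies the same hypothesis, so all Taylor coefficients vanish along with
`u 0`. -/
theorem eq_zero_of_flow_eq_zero (N : Module.End K V) (u : ℕ → V) (hu : ∀ l, flow N l u = 0) :
    u = 0 := by
  ext j
  induction j generalizing u with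
  | zero => simpa using hu 0
  | succ j ih =>
    have h := ih (deriv (K := K) u) fun l => by
      have := smul_flow_succ N l u
      simpa [hu] using this.symm
    simpa [Nat.cast_add_one_ne_zero j] using h

end CharZero

variable {V₁ V₂ V₃ : Type*} [AddCommGroup V₁] [Module K V₁] [AddCommGroup V₂] [Module K V₂]
  [AddCommGroup V₃] [Module K V₃]

/-- The product of two formal curves. -/
def conv (B : V₁ →ₗ[K] V₂ →ₗ[K] V₃) (u : ℕ → V₁) (v : ℕ → V₂) (l : ℕ) : V₃ :=
  ∑ p ∈ Finset.HasAntidiagonal.antidiagonal l, B (u p.1) (v p.2)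

theorem deriv_conv (B : V₁ →ₗ[K] V₂ →ₗ[K] V₃) (u : ℕ → V₁) (v : ℕ → V₂) :
    deriv (K := K) (conv B u v) =
      conv B (deriv (K := K) u) v + conv B u (deriv (K := K) v) := by
  ext l
  have h1 : (((l : K) + 1) • conv B u v (l + 1)) =
      ∑ p ∈ Finset.HasAntidiagonal.antidiagonal (l + 1), ((p.1 : K) • B (u p.1) (v p.2) +
        (p.2 : K) • B (u p.1) (v p.2)) := by
    rw [conv, Finset.smul_sum]
    refine Finset.sum_congr rfl fun p hp => ?_
    rw [← add_smul, ← Nat.cast_add, Finset.HasAntidiagonal.mem_antidiagonal.1 hp]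
    push_cast; rfl
  rw [deriv_apply, h1, Finset.sum_add_distrib, Finset.Nat.sum_antidiagonal_succ,
    Finset.Nat.sum_antidiagonal_succ']
  simp [conv]

/-- Under `hB` both sides agree at s = 0 and obey the same differential equation. -/
theorem flow_conv [CharZero K] (B : V₁ →ₗ[K] V₂ →ₗ[K] V₃) (N₁ : Module.End K V₁)
    (N₂ : Module.End K V₂) (N₃ : Module.End K V₃)
    (hB : ∀ x y, N₃ (B x y) = B (N₁ x) y + B x (N₂ y)) (l : ℕ) (u : ℕ → V₁) (v : ℕ → V₂) :
    flow N₃ l (conv B u v) = conv B (fun j => flow N₁ j u) (fun j => flow N₂ j v) l := by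
  induction l generalizing u v with
  | zero => simp [conv]
  | succ l ih =>
    refine smul_right_injective V₃ (Nat.cast_add_one_ne_zero (R := K) l) ?_
    dsimp only
    rw [smul_flow_succ, deriv_conv, map_add, ih, ih, ih]
    have h := congrFun (deriv_conv B (fun j => flow N₁ j u) (fun j => flow N₂ j v)) l
    rw [deriv_apply] at h
    rw [h, Pi.add_apply]
    have e1 : deriv (K := K) (fun j => flow N₁ j u) =
        (fun j => N₁ (flow N₁ j u)) + fun j => flow N₁ j (deriv (K := K) u) := by
      ext j; rw [deriv_apply, smul_flow_succ]; rfl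
    have e2 : deriv (K := K) (fun j => flow N₂ j v) =
        (fun j => N₂ (flow N₂ j v)) + fun j => flow N₂ j (deriv (K := K) v) := by
      ext j; rw [deriv_apply, smul_flow_succ]; rfl
    rw [e1, e2]
    simp only [conv, map_sum, hB, Pi.add_apply, map_add, LinearMap.add_apply,
      Finset.sum_add_distrib]
    abel

/-- `x` is the leading coefficient, at `s ^ m`, of a curve `exp (s N) u(s)` with `u` in `U`. -/
def IsLeading (N : Module.End K V) (U : Submodule K V) (m : ℕ) (x : V) : Prop :=
  ∃ u : ℕ → V, (∀ j, u j ∈ U) ∧ flow N m u = x ∧ ∀ l, m < l → flow N l u = 0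

theorem IsLeading.add_right [CharZero K] {N : Module.End K V} {U : Submodule K V} {m : ℕ} {x : V}
    (h : IsLeading N U m x) (i : ℕ) : IsLeading N U (m + i) x := by
  induction i with
  | zero => exact h
  | succ i ih =>
    obtain ⟨u, hu, hx, hl⟩ := ih
    refine ⟨shift u, fun j => ?_, ?_, fun l h => ?_⟩
    · cases j with
      | zero => exact U.zero_mem
      | succ j => exact hu j
    · rw [← add_assoc, (flow_shift N _ u).1, hx]
    · obtain ⟨l, rfl⟩ : ∃ l', l = l' + 1 := ⟨l - 1, by omega⟩
      rw [(flow_shift N _ u).1, hl l (by omega)]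

theorem IsLeading.mono [CharZero K] {N : Module.End K V} {U : Submodule K V} {m m' : ℕ} {x : V}
    (h : IsLeading N U m x) (hm : m ≤ m') : IsLeading N U m' x := by
  obtain ⟨i, rfl⟩ := Nat.exists_eq_add_of_le hm
  exact h.add_right i

/-- The limit of the subspaces `exp (s N) U` as `s` tends to infinity. -/
def limit [CharZero K] (N : Module.End K V) (U : Submodule K V) : Submodule K V where
  carrier := {x | ∃ m, IsLeading N U m x}
  add_mem' := by
    rintro x y ⟨m, hx⟩ ⟨n, hy⟩
    obtain ⟨u, hu, hux, hul⟩ := hx.mono (le_max_left m n)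
    obtain ⟨v, hv, hvy, hvl⟩ := hy.mono (le_max_right m n)
    exact ⟨max m n, u + v, fun j => U.add_mem (hu j) (hv j), by rw [map_add, hux, hvy],
      fun l hl => by rw [map_add, hul l hl, hvl l hl, add_zero]⟩
  zero_mem' := ⟨0, 0, fun _ => U.zero_mem, by simp, fun l _ => map_zero _⟩
  smul_mem' := by
    rintro c x ⟨m, u, hu, hux, hul⟩
    exact ⟨m, c • u, fun j => U.smul_mem c (hu j), by rw [map_smul, hux],
      fun l hl => by rw [map_smul, hul l hl, smul_zero]⟩

theorem flow_mem {N : Module.End K V} {U : Submodule K V} (hU : ∀ x ∈ U, N x ∈ U) (l : ℕ)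
    {u : ℕ → V} (hu : ∀ j, u j ∈ U) : flow N l u ∈ U := by
  induction l generalizing u with
  | zero => exact hu 0
  | succ l ih =>
    rw [flow_succ]
    exact U.smul_mem _ (U.add_mem (hU _ (ih hu)) (ih fun j => U.smul_mem _ (hu _)))

/-- Finite sequences in `U` as formal curves. -/
def extend (U : Submodule K V) (m : ℕ) : (Fin m → U) →ₗ[K] (ℕ → V) where
  toFun w j := if h : j < m then (w ⟨j, h⟩ : V) else 0
  map_add' w w' := by ext j; by_cases h : j < m <;> simp [h]
  map_smul' c w := by ext j; by_cases h : j < m <;> simp [h]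

theorem extend_mem (U : Submodule K V) (m : ℕ) (w : Fin m → U) (j : ℕ) : extend U m w j ∈ U := by
  by_cases h : j < m
  · simp [extend, h]
  · simp [extend, h]

theorem extend_injective (U : Submodule K V) (m : ℕ) : Function.Injective (extend U m) := by
  intro w w' h
  ext j
  have := congrFun h j
  simpa [extend] using this

section Limit

variable [CharZero K]

theorem limit_mono (N : Module.End K V) {U W : Submodule K V} (h : U ≤ W) :
    limit N U ≤ limit N W := by
  rintro x ⟨m, u, hu, hx⟩
  exact ⟨m, u, fun j => h (hu j), hx⟩

/-- If exp(sN) u has degree at most m, the differential equation shows that exp(sN) u' has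
coefficient -N x at s^m and nothing above. -/
theorem map_mem_limit (N : Module.End K V) {U : Submodule K V} {x : V} (hx : x ∈ limit N U) :
    N x ∈ limit N U := by
  obtain ⟨m, u, hu, rfl, hl⟩ := hx
  rw [← neg_mem_iff]
  have key : ∀ l, m ≤ l → flow N l (deriv (K := K) u) = -N (flow N l u) := fun l h => by
    rw [eq_neg_iff_add_eq_zero, add_comm, ← smul_flow_succ, hl _ (by omega), smul_zero]
  exact ⟨m, deriv (K := K) u, fun j => U.smul_mem _ (hu _), key m le_rfl,
    fun l h => by rw [key l h.le, hl l h, map_zero, neg_zero]⟩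

/-- The top coefficient of a product of curves is the product of the top coefficients; leading
coefficients are allowed to vanish, so no cancellation has to be excluded. -/
theorem bilin_mem_limit {B : V₁ →ₗ[K] V₂ →ₗ[K] V₃} {N₁ : Module.End K V₁}
    {N₂ : Module.End K V₂} {N₃ : Module.End K V₃}
    (hB : ∀ x y, N₃ (B x y) = B (N₁ x) y + B x (N₂ y)) {U₁ : Submodule K V₁}
    {U₂ : Submodule K V₂} {U₃ : Submodule K V₃} (hU : ∀ x ∈ U₁, ∀ y ∈ U₂, B x y ∈ U₃)
    {x : V₁} {y : V₂} (hx : x ∈ limit N₁ U₁) (hy : y ∈ limit N₂ U₂) : B x y ∈ limit N₃ U₃ := by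
  obtain ⟨m, u, hu, rfl, hul⟩ := hx
  obtain ⟨n, v, hv, rfl, hvl⟩ := hy
  refine ⟨m + n, conv B u v, fun j => Submodule.sum_mem _ fun p _ => hU _ (hu _) _ (hv _), ?_,
    fun l hl => ?_⟩
  · rw [flow_conv B N₁ N₂ N₃ hB, conv, Finset.sum_eq_single (m, n)]
    · rintro ⟨i, j⟩ hp hne
      rw [Finset.HasAntidiagonal.mem_antidiagonal] at hp
      dsimp only at hp ⊢
      rcases lt_trichotomy i m with h | h | h
      · rw [hvl j (by omega), map_zero]
      · exact absurd (Prod.ext h (by dsimp only; omega)) hne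
      · rw [hul i h, map_zero, LinearMap.zero_apply]
    · intro h
      exact absurd (Finset.HasAntidiagonal.mem_antidiagonal.2 (by rfl)) h
  · rw [flow_conv B N₁ N₂ N₃ hB, conv]
    refine Finset.sum_eq_zero ?_
    rintro ⟨i, j⟩ hp
    rw [Finset.HasAntidiagonal.mem_antidiagonal] at hp
    dsimp only at hp ⊢
    rcases le_or_gt i m with h | h
    · rw [hvl j (by omega), map_zero]
    · rw [hul i h, map_zero, LinearMap.zero_apply]

theorem limit_le {N : Module.End K V} {U : Submodule K V} (hU : ∀ x ∈ U, N x ∈ U) :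
    limit N U ≤ U := by
  rintro x ⟨m, u, hu, rfl, -⟩
  exact flow_mem hU m hu

/-- The finite sequences in `U` whose flow has degree less than `l`. -/
def degreeLT (N : Module.End K V) (U : Submodule K V) (m l : ℕ) : Submodule K (Fin m → U) where
  carrier := {w | ∀ j, l ≤ j → flow N j (extend U m w) = 0}
  add_mem' hx hy j hj := by rw [map_add, map_add, hx j hj, hy j hj, add_zero]
  zero_mem' j _ := by simp
  smul_mem' c w hw j hj := by rw [map_smul, map_smul, hw j hj, smul_zero]

variable [FiniteDimensional K V]

/-- The coefficient at s^l maps sequences with flow of degree at most l into the limit, with kernel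
those of degree below l. So each unit of degree adds at most the dimension of the limit. -/
theorem finrank_degreeLT_le (N : Module.End K V) (U : Submodule K V) (m l : ℕ) :
    finrank K (degreeLT N U m l) ≤ l * finrank K (limit N U) := by
  induction l with
  | zero =>
    have : degreeLT N U m 0 = ⊥ := by
      refine (Submodule.eq_bot_iff _).2 fun w hw => extend_injective U m ?_
      rw [map_zero]
      exact eq_zero_of_flow_eq_zero N _ fun l => hw l (Nat.zero_le _)
    rw [this]; simp
  | succ l ih =>
    let f : degreeLT N U m (l + 1) →ₗ[K] limit N U :=
      ((flow N l ∘ₗ extend U m).domRestrict _).codRestrict _ fun w =>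
        ⟨l, extend U m w, extend_mem U m _, rfl, fun j hj => w.2 j hj⟩
    have h1 := f.finrank_range_add_finrank_ker
    have h2 : finrank K (LinearMap.range f) ≤ finrank K (limit N U) := Submodule.finrank_le _
    have h3 : finrank K (LinearMap.ker f) ≤ finrank K (degreeLT N U m l) := by
      let g : LinearMap.ker f →ₗ[K] degreeLT N U m l :=
        ((degreeLT N U m (l + 1)).subtype ∘ₗ (LinearMap.ker f).subtype).codRestrict _ fun w j hj => by
          rcases hj.eq_or_lt with rfl | hj
          · exact congrArg Subtype.val (LinearMap.mem_ker.1 w.2)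
          · exact w.1.2 j hj
      refine LinearMap.finrank_le_finrank_of_injective (f := g) fun a b h => ?_
      exact Subtype.ext (Subtype.ext (congrArg (fun w : degreeLT N U m l => (w : Fin m → U)) h))
    rw [Nat.succ_mul]
    omega

/-- Asymptotic counting: the curves in U of degree below m form a space of dimension m · dim U, and
if N^k = 0 their flows have degree below m + k. So m · dim U ≤ (m + k) · dim (limit), which for
large m gives the claim. -/
theorem finrank_le_finrank_limit {N : Module.End K V} (hN : IsNilpotent N) (U : Submodule K V) :
    finrank K U ≤ finrank K (limit N U) := by
  obtain ⟨k, hk⟩ := hN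
  by_contra! hlt
  set D := finrank K (limit N U)
  -- Just large enough: m (D + 1) ≤ (m + k) D would force m ≤ k D.
  set m := k * D + 1
  have htop : degreeLT N U m (m + k) = ⊤ := by
    refine eq_top_iff.2 fun w _ j hj => ?_
    obtain ⟨v, hv⟩ := flow_mem_range_pow N j m (extend U m w) fun i hi => by
      simp [extend, Nat.not_lt.2 hi]
    rw [← hv, show j + 1 - m = (j + 1 - m - k) + k by omega, pow_add, hk, mul_zero]
    rfl
  have h := finrank_degreeLT_le N U m (m + k)
  rw [htop, finrank_top, Module.finrank_pi_fintype, Finset.sum_const, Finset.card_univ,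
    Fintype.card_fin, smul_eq_mul] at h
  have h' : m * (D + 1) ≤ (m + k) * D := (Nat.mul_le_mul_left m hlt).trans h
  have : m ≤ k * D := by linarith
  exact absurd this (by simp [m])

/-- The upper bound is the lower bound for the annihilator of U under the contragredient flow. The
evaluation pairing is invariant, whence `N₃ := 0`, so the limit of the annihilator annihilates the
limit. -/
theorem finrank_limit {N : Module.End K V} (hN : IsNilpotent N) (U : Submodule K V) :
    finrank K (limit N U) = finrank K U := by
  refine le_antisymm ?_ (finrank_le_finrank_limit hN U)
  let N' : Module.End K (Dual K V) := (-N).dualMap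
  have hN' : IsNilpotent N' := by
    obtain ⟨k, hk⟩ := hN.neg
    have : ∀ j, N' ^ j = ((-N) ^ j).dualMap := by
      intro j
      induction j with
      | zero => ext; simp
      | succ j ih => rw [pow_succ', ih, pow_succ]; ext; rfl
    refine ⟨k, ?_⟩
    rw [this, hk]
    ext; simp
  have h1 := finrank_le_finrank_limit hN' U.dualAnnihilator
  have h2 : limit N' U.dualAnnihilator ≤ (limit N U).dualAnnihilator := by
    intro ξ hξ
    rw [Submodule.mem_dualAnnihilator]
    intro x hx
    have h := bilin_mem_limit (B := Dual.eval K V) (N₁ := N) (N₂ := N') (N₃ := 0)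
      (fun x ξ => by simp [N']) (U₃ := ⊥)
      (fun x hx ξ hξ => (Submodule.mem_dualAnnihilator ξ).1 hξ x hx) hx hξ
    exact (Submodule.mem_bot K).1 (limit_le (fun _ _ => Submodule.zero_mem _) h)
  have h3 := Submodule.finrank_mono h2
  have h4 := Subspace.finrank_add_finrank_dualAnnihilator_eq U
  have h5 := Subspace.finrank_add_finrank_dualAnnihilator_eq (limit N U)
  omega

theorem limit_eq_of_invariant {N : Module.End K V} (hN : IsNilpotent N) {U : Submodule K V}
    (hU : ∀ x ∈ U, N x ∈ U) : limit N U = U :=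
  Submodule.eq_of_le_of_finrank_eq (limit_le hU) (finrank_limit hN U)

end Limit

end UnipotentLimit

/-! ### Associated graded subspaces -/

namespace GradedLimit

variable {K : Type*} [Field K] {ι : Type*} [LinearOrder ι]
variable {V : Type*} [AddCommGroup V] [Module K V]

/-- The sum of the pieces of degree less than `c`. -/
def below (A : ι → Submodule K V) (c : ι) : Submodule K V := ⨆ (d) (_ : d < c), A d

/-- The components of degree `c` of the elements of `U` of degree at most `c`. -/
def lead (A : ι → Submodule K V) (U : Submodule K V) (c : ι) : Submodule K V :=
  A c ⊓ (U ⊔ below A c)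

/-- The associated graded subspace of `U`. -/
def gr (A : ι → Submodule K V) (U : Submodule K V) : Submodule K V := ⨆ c, lead A U c

variable {A : ι → Submodule K V}

theorem le_below {c d : ι} (h : d < c) : A d ≤ below A c :=
  le_iSup₂_of_le d h le_rfl

theorem below_mono {c d : ι} (h : d ≤ c) : below A d ≤ below A c :=
  iSup₂_le fun _ he => le_below (he.trans_le h)

theorem lead_le (U : Submodule K V) (c : ι) : lead A U c ≤ A c := inf_le_left

theorem lead_mono {U W : Submodule K V} (h : U ≤ W) (c : ι) : lead A U c ≤ lead A W c :=
  inf_le_inf_left _ (sup_le_sup_right h _)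

theorem gr_mono {U W : Submodule K V} (h : U ≤ W) : gr A U ≤ gr A W :=
  iSup_mono (lead_mono h)

theorem disjoint_below (hA : iSupIndep A) (c : ι) : Disjoint (A c) (below A c) := by
  refine (hA c).mono_right ?_
  exact iSup₂_le fun d hd => le_iSup₂_of_le d hd.ne le_rfl

/-- Peel off the highest degree c: modulo lower degrees U and `lead A U c` coincide, and the part of
U in lower degrees has the same leading spaces there as U. -/
theorem finrank_eq_finrank_iSup_lead [FiniteDimensional K V] (hA : iSupIndep A) (S : Finset ι)
    (U : Submodule K V) (hU : U ≤ ⨆ c ∈ S, A c) :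
    finrank K U = finrank K (⨆ c ∈ S, lead A U c : Submodule K V) := by
  classical
  induction S using Finset.induction_on_max generalizing U with
  | empty =>
    obtain rfl : U = ⊥ := by simpa using hU
    rw [show (⨆ c ∈ (∅ : Finset ι), lead A ⊥ c) = ⊥ by simp]
  | insert c S hc ih =>
    set VS : Submodule K V := ⨆ d ∈ S, A d
    have hVS : VS ≤ below A c := iSup₂_le fun d hd => le_below (hc d hd)
    rw [Finset.iSup_insert] at hU ⊢
    have hdec : ∀ u ∈ U, ∃ a ∈ A c, ∃ v ∈ VS, a + v = u := fun u hu => Submodule.mem_sup.1 (hU hu)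
    have hdis := Submodule.disjoint_def.1 (disjoint_below hA c)
    have hsup : U ⊔ VS = lead A U c ⊔ VS := by
      apply le_antisymm
      · refine sup_le (fun u hu => ?_) le_sup_right
        obtain ⟨a, ha, v, hv, rfl⟩ := hdec u hu
        refine Submodule.add_mem_sup ⟨ha, ?_⟩ hv
        exact Submodule.mem_sup.2 ⟨_, hu, -v, neg_mem (hVS hv), by abel⟩
      · refine sup_le ?_ le_sup_right
        rintro x ⟨hx, hx'⟩
        obtain ⟨u, hu, l, hl, rfl⟩ := Submodule.mem_sup.1 hx'
        obtain ⟨a, ha, v, hv, rfl⟩ := hdec u hu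
        have : v + l = 0 := hdis _ (by
          have := sub_mem hx ha
          rwa [show a + v + l - a = v + l by abel] at this) (add_mem (hVS hv) hl)
        exact Submodule.mem_sup.2 ⟨_, hu, -v, neg_mem hv, by
          rw [eq_neg_of_add_eq_zero_right this]⟩
    have hlead : ∀ d ∈ S, lead A (U ⊓ VS) d = lead A U d := by
      intro d hd
      refine le_antisymm (lead_mono inf_le_left d) ?_
      rintro x ⟨hx, hx'⟩
      obtain ⟨u, hu, l, hl, rfl⟩ := Submodule.mem_sup.1 hx'
      refine ⟨hx, Submodule.add_mem_sup ⟨hu, ?_⟩ hl⟩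
      obtain ⟨a, ha, v, hv, rfl⟩ := hdec u hu
      have : a = 0 := hdis _ ha (by
        have h1 := sub_mem (le_below (hc d hd) hx) (add_mem (hVS hv) (below_mono (hc d hd).le hl))
        rwa [show a + v + l - (v + l) = a by abel] at h1)
      simpa [this] using hv
    have ih' := ih (U ⊓ VS) inf_le_right
    rw [iSup_congr fun d => iSup_congr (hlead d)] at ih'
    have h1 := Submodule.finrank_sup_add_finrank_inf_eq U VS
    have h2 := Submodule.finrank_sup_add_finrank_inf_eq (lead A U c) VS
    have h3 := Submodule.finrank_sup_add_finrank_inf_eq (lead A U c) (⨆ d ∈ S, lead A U d)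
    have hd : Disjoint (lead A U c) VS :=
      (disjoint_below hA c).mono (lead_le U c) hVS
    have hd' : Disjoint (lead A U c) (⨆ d ∈ S, lead A U d) :=
      hd.mono_right (iSup₂_mono fun d _ => lead_le U d)
    rw [hd.eq_bot, finrank_bot] at h2
    rw [hd'.eq_bot, finrank_bot] at h3
    rw [hsup] at h1
    omega

theorem finrank_gr [FiniteDimensional K V] (hA : iSupIndep A) (hA' : iSup A = ⊤)
    (U : Submodule K V) : finrank K (gr A U) = finrank K U := by
  have hfin : {c | A c ≠ ⊥}.Finite := WellFoundedGT.finite_ne_bot_of_iSupIndep hA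
  have h : ∀ B : ι → Submodule K V, (∀ c, B c ≤ A c) → ⨆ c ∈ hfin.toFinset, B c = ⨆ c, B c := by
    intro B hB
    refine le_antisymm (iSup₂_le fun c _ => le_iSup B c) (iSup_le fun c => ?_)
    by_cases hc : A c = ⊥
    · exact (hB c).trans (hc.le.trans bot_le)
    · exact le_iSup₂_of_le c (by simpa using hc) le_rfl
  rw [finrank_eq_finrank_iSup_lead hA hfin.toFinset U
    (by rw [h A fun _ => le_rfl, hA']; exact le_top), h _ (lead_le U), gr]

theorem gr_eq_of_graded [FiniteDimensional K V] (hA : iSupIndep A) (hA' : iSup A = ⊤)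
    {U : Submodule K V} (hU : U ≤ ⨆ c, U ⊓ A c) : gr A U = U := by
  refine (Submodule.eq_of_le_of_finrank_eq (hU.trans (iSup_mono fun c => ?_))
    (finrank_gr hA hA' U).symm).symm
  exact le_inf inf_le_right (inf_le_left.trans le_sup_left)

theorem map_mem_gr_of_mapsTo {M : Module.End K V} (hM : ∀ c, ∀ x ∈ A c, M x ∈ A c)
    {U : Submodule K V} (hU : ∀ x ∈ U, M x ∈ U) {x : V} (hx : x ∈ gr A U) : M x ∈ gr A U := by
  have hbelow : ∀ c, below A c ≤ (below A c).comap M := fun c =>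
    iSup₂_le fun d hd x hx => le_below hd (hM d x hx)
  suffices gr A U ≤ (gr A U).comap M from this hx
  refine iSup_le fun c x hx => Submodule.mem_iSup_of_mem c ⟨hM c x hx.1, ?_⟩
  obtain ⟨u, hu, l, hl, rfl⟩ := Submodule.mem_sup.1 hx.2
  rw [map_add]
  exact Submodule.add_mem_sup (hU u hu) (hbelow c hl)

theorem map_mem_gr_of_smul {M : Module.End K V} (hM : ∀ c, ∀ x ∈ A c, ∃ a : K, M x = a • x)
    {U : Submodule K V} {x : V} (hx : x ∈ gr A U) : M x ∈ gr A U := by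
  suffices gr A U ≤ (gr A U).comap M from this hx
  refine iSup_le fun c x hx => Submodule.mem_iSup_of_mem c ?_
  obtain ⟨a, ha⟩ := hM c x hx.1
  rw [ha]
  exact Submodule.smul_mem _ a hx

/-- Leading components multiply: if x = u + l and y = v + m with l, m of lower degree, then B x y
differs from B u v by terms of degree below c + d. -/
theorem bilin_mem_gr [AddCommGroup ι] [IsOrderedAddMonoid ι] {B : V →ₗ[K] V →ₗ[K] V}
    (hB : ∀ c d, ∀ x ∈ A c, ∀ y ∈ A d, B x y ∈ A (c + d)) {U₁ U₂ U₃ : Submodule K V}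
    (hU : ∀ x ∈ U₁, ∀ y ∈ U₂, B x y ∈ U₃) {x y : V} (hx : x ∈ gr A U₁) (hy : y ∈ gr A U₂) :
    B x y ∈ gr A U₃ := by
  have h1 : ∀ c d, ∀ x ∈ below A c, ∀ y ∈ A d, B x y ∈ below A (c + d) := by
    intro c d x hx y hy
    suffices below A c ≤ (below A (c + d)).comap (B.flip y) from this hx
    exact iSup₂_le fun e he x hx => le_below (add_lt_add_left he d) (hB e d x hx y hy)
  have h2 : ∀ c d, ∀ x ∈ A c, ∀ y ∈ below A d, B x y ∈ below A (c + d) := by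
    intro c d x hx y hy
    suffices below A d ≤ (below A (c + d)).comap (B x) from this hy
    exact iSup₂_le fun e he y hy => le_below (add_lt_add_right he c) (hB c e x hx y hy)
  have h3 : ∀ c d, ∀ x ∈ below A c, ∀ y ∈ below A d, B x y ∈ below A (c + d) := by
    intro c d x hx y hy
    suffices below A d ≤ (below A (c + d)).comap (B x) from this hy
    exact iSup₂_le fun e he y hy =>
      below_mono (add_lt_add_right he c).le (h1 c e x hx y hy)
  have key : ∀ c d, ∀ x ∈ lead A U₁ c, ∀ y ∈ lead A U₂ d, B x y ∈ lead A U₃ (c + d) := by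
    rintro c d x ⟨hx, hx'⟩ y ⟨hy, hy'⟩
    refine ⟨hB c d x hx y hy, ?_⟩
    obtain ⟨u, hu, l, hl, hul⟩ := Submodule.mem_sup.1 hx'
    obtain ⟨v, hv, m, hm, hvm⟩ := Submodule.mem_sup.1 hy'
    refine Submodule.mem_sup.2 ⟨B u v, hU u hu v hv, B x m - B l m + B l y, ?_, ?_⟩
    · exact add_mem (sub_mem (h2 c d x hx m hm) (h3 c d l hl m hm)) (h1 c d l hl y hy)
    · rw [← hul, ← hvm]
      simp only [map_add, LinearMap.add_apply]
      abel
  suffices gr A U₁ ≤ (gr A U₃).comap (B.flip y) from this hx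
  refine iSup_le fun c x hx => ?_
  suffices gr A U₂ ≤ (gr A U₃).comap (B x) from this hy
  exact iSup_le fun d y hy => Submodule.mem_iSup_of_mem (c + d) (key c d x hx y hy)

end GradedLimit

/-! ### Degenerations of a Lie algebra along an element with eigenvalues in the field -/

section Degeneration

variable {𝔤 : Type*} [LieRing 𝔤] [LieAlgebra ℝ 𝔤] [FiniteDimensional ℝ 𝔤]

open Module.End in
/-- The Jordan decomposition of `ad T`. -/
theorem exists_derivation_jordan {T : 𝔤} (hT : ⨆ μ : ℝ, (LieAlgebra.ad ℝ 𝔤 T).maxGenEigenspace μ = ⊤) :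
    ∃ N ∈ Algebra.adjoin ℝ {LieAlgebra.ad ℝ 𝔤 T}, IsNilpotent N ∧
      (∀ x y, N ⁅x, y⁆ = ⁅N x, y⁆ + ⁅x, N y⁆) ∧
      ∀ c, ∀ x ∈ (LieAlgebra.ad ℝ 𝔤 T).maxGenEigenspace c, ⁅T, x⁆ = c • x + N x := by
  obtain ⟨N, hN₀, S, hS₀, hN, hS, hSN⟩ := (LieAlgebra.ad ℝ 𝔤 T).exists_isNilpotent_isSemisimple
  refine ⟨N, hN₀, hN, ?_⟩
  replace hS₀ : Commute (LieAlgebra.ad ℝ 𝔤 T) S := Algebra.commute_of_mem_adjoin_self hS₀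
  have hN' : IsNilpotent (LieAlgebra.ad ℝ 𝔤 T - S) := by rwa [hSN, add_sub_cancel_right]
  have aux {c : ℝ} {y : 𝔤} (hy : y ∈ (LieAlgebra.ad ℝ 𝔤 T).maxGenEigenspace c) : S y = c • y := by
    rw [maxGenEigenspace_eq] at hy
    rw [apply_eq_of_mem_of_comm_of_isFinitelySemisimple_of_isNil hy hS₀ hS.isFinitelySemisimple hN']
  -- S is multiplication by c on the generalized eigenspace of c, and eigenvalues add under the
  -- bracket. So S is a derivation, and then so is N = ad T - S.
  have hder : ∀ y z : 𝔤, S ⁅y, z⁆ = ⁅S y, z⁆ + ⁅y, S z⁆ := by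
    intro y z
    have hy : y ∈ ⨆ μ : ℝ, (LieAlgebra.ad ℝ 𝔤 T).maxGenEigenspace μ := by simp [hT]
    have hz : z ∈ ⨆ μ : ℝ, (LieAlgebra.ad ℝ 𝔤 T).maxGenEigenspace μ := by simp [hT]
    induction hy using Submodule.iSup_induction' with
    | mem α y hy =>
      induction hz using Submodule.iSup_induction' with
      | mem β z hz =>
        have hyz := LieModule.lie_mem_maxGenEigenspace_toEnd (L := 𝔤) (M := 𝔤) hy hz
        rw [aux hy, aux hz, aux hyz, smul_lie, lie_smul, ← add_smul]
      | zero => simp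
      | add _ _ _ _ h h' => simp only [lie_add, map_add, h, h']; abel
    | zero => simp
    | add _ _ _ _ h h' => simp only [add_lie, map_add, h, h']; abel
  have happ : ∀ x, ⁅T, x⁆ = N x + S x := fun x => by
    rw [← LieAlgebra.ad_apply (R := ℝ), hSN]; rfl
  refine ⟨fun x y => ?_, fun c x hx => by rw [happ, aux hx, add_comm]⟩
  have h := leibniz_lie T x y
  rw [happ, happ, happ, hder, add_lie, lie_add] at h
  have h' : N ⁅x, y⁆ = ⁅N x, y⁆ + ⁅S x, y⁆ + (⁅x, N y⁆ + ⁅x, S y⁆) - (⁅S x, y⁆ + ⁅x, S y⁆) :=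
    eq_sub_of_add_eq h
  rw [h']; abel

variable (𝔤) in
/-- The Lie bracket as a bilinear map. -/
def lieBilin : 𝔤 →ₗ[ℝ] 𝔤 →ₗ[ℝ] 𝔤 :=
  LinearMap.mk₂ ℝ (fun x y => ⁅x, y⁆) add_lie (fun c x y => smul_lie c x y) lie_add
    (fun c x y => lie_smul c x y)

/-- A degeneration of `𝔤` along `T`: it preserves inclusions, dimensions and brackets of subspaces,
its values are `ad T`-invariant, and it fixes the `ad T`-invariant subspaces. -/
theorem exists_degeneration {T : 𝔤}
    (hT : ⨆ μ : ℝ, (LieAlgebra.ad ℝ 𝔤 T).maxGenEigenspace μ = ⊤) :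
    ∃ D : Submodule ℝ 𝔤 → Submodule ℝ 𝔤, Monotone D ∧
      (∀ U, finrank ℝ (D U) = finrank ℝ U) ∧
      (∀ U₁ U₂ U₃ : Submodule ℝ 𝔤, (∀ x ∈ U₁, ∀ y ∈ U₂, ⁅x, y⁆ ∈ U₃) →
        ∀ x ∈ D U₁, ∀ y ∈ D U₂, ⁅x, y⁆ ∈ D U₃) ∧
      (∀ U, ∀ x ∈ D U, ⁅T, x⁆ ∈ D U) ∧
      (∀ U : Submodule ℝ 𝔤, (∀ x ∈ U, ⁅T, x⁆ ∈ U) → D U = U) := by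
  obtain ⟨N, hNadj, hN, hder, hTN⟩ := exists_derivation_jordan hT
  set A : ℝ → Submodule ℝ 𝔤 := (LieAlgebra.ad ℝ 𝔤 T).maxGenEigenspace
  have hA : iSupIndep A := Module.End.independent_maxGenEigenspace _
  have hNcomm : Commute (LieAlgebra.ad ℝ 𝔤 T) N := Algebra.commute_of_mem_adjoin_self hNadj
  have hNA : ∀ c, ∀ x ∈ A c, N x ∈ A c := fun c x hx =>
    Module.End.mapsTo_maxGenEigenspace_of_comm hNcomm c hx
  have hlie : ∀ c d, ∀ x ∈ A c, ∀ y ∈ A d, (lieBilin 𝔤) x y ∈ A (c + d) :=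
    fun c d x hx y hy => LieModule.lie_mem_maxGenEigenspace_toEnd (L := 𝔤) (M := 𝔤) hx hy
  -- The limit is taken in two stages: leading coefficients under exp(sN), then leading components
  -- for the eigenvalue grading.
  refine ⟨fun U => GradedLimit.gr A (UnipotentLimit.limit N U), fun U W h =>
    GradedLimit.gr_mono (UnipotentLimit.limit_mono N h), fun U => ?_, ?_, ?_, ?_⟩
  · rw [GradedLimit.finrank_gr hA hT, UnipotentLimit.finrank_limit hN]
  · intro U₁ U₂ U₃ hU x hx y hy
    refine GradedLimit.bilin_mem_gr (B := (lieBilin 𝔤)) hlie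
      (fun x hx y hy => ?_) hx hy
    exact UnipotentLimit.bilin_mem_limit (B := (lieBilin 𝔤)) hder hU hx hy
  · intro U x hx
    let S : Module.End ℝ 𝔤 := LieAlgebra.ad ℝ 𝔤 T - N
    have hS : ∀ c, ∀ x ∈ A c, ∃ a : ℝ, S x = a • x := fun c x hx =>
      ⟨c, by simp [S, hTN c x hx]⟩
    have h1 := GradedLimit.map_mem_gr_of_smul hS hx
    have h2 := GradedLimit.map_mem_gr_of_mapsTo hNA
      (fun x hx => UnipotentLimit.map_mem_limit N hx) hx
    have h3 := add_mem h1 h2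
    simpa [S] using h3
  · intro U hU
    -- N is a polynomial in ad T, so it preserves every ad T-invariant subspace.
    have hNU : ∀ x ∈ U, N x ∈ U := by
      intro x hx
      have : ∀ M ∈ Algebra.adjoin ℝ {LieAlgebra.ad ℝ 𝔤 T}, ∀ x ∈ U, M x ∈ U := by
        intro M hM
        induction hM using Algebra.adjoin_induction with
        | mem M hM =>
          rw [Set.mem_singleton_iff] at hM
          subst hM
          exact fun x hx => hU x hx
        | algebraMap r => exact fun x hx => U.smul_mem r hx
        | add M M' _ _ h h' => exact fun x hx => U.add_mem (h x hx) (h' x hx)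
        | mul M M' _ _ h h' => exact fun x hx => h _ (h' x hx)
      exact this N hNadj x hx
    dsimp only
    rw [UnipotentLimit.limit_eq_of_invariant hN hNU]
    refine GradedLimit.gr_eq_of_graded hA hT ?_
    have h := Submodule.inf_iSup_genEigenspace (f := LieAlgebra.ad ℝ 𝔤 T) hU ⊤
    have hT' : ⨆ μ, (LieAlgebra.ad ℝ 𝔤 T).genEigenspace μ ⊤ = ⊤ := hT
    rw [hT', inf_top_eq] at h
    exact h.le

end Degeneration

/-! ### Triangular subalgebras -/

namespace Triangular

open CRAlg

variable {𝔤 : Type*} [LieRing 𝔤] [LieAlgebra ℝ 𝔤]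

/-- `F` is invariant under `ad X` for all `X` in `𝔱`. -/
def Stable (𝔱 : LieSubalgebra ℝ 𝔤) (F : Submodule ℝ 𝔤) : Prop := ∀ X ∈ 𝔱, ∀ y ∈ F, ⁅X, y⁆ ∈ F

/-- `F` is a full flag of subspaces invariant under `ad 𝔱`. -/
structure IsFlag (𝔱 : LieSubalgebra ℝ 𝔤) (n : ℕ) (F : ℕ → Submodule ℝ 𝔤) : Prop where
  zero : F 0 = ⊥
  top : F n = ⊤
  le_succ : ∀ i, F i ≤ F (i + 1)
  -- Only a bound, since the sequence is constant from n on.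
  finrank_succ_le : ∀ i, finrank ℝ (F (i + 1)) ≤ finrank ℝ (F i) + 1
  stable : ∀ i, Stable 𝔱 (F i)

variable {𝔱 𝔰 : LieSubalgebra ℝ 𝔤}

theorem IsTriangular.mono (h : IsTriangular 𝔱) (hs : 𝔰 ≤ 𝔱) : IsTriangular 𝔰 := by
  obtain ⟨n, e, he⟩ := h
  exact ⟨n, e, fun X hX => he X (hs hX)⟩

variable [FiniteDimensional ℝ 𝔤]

theorem _root_.Submodule.eq_sup_span_singleton_of_finrank_le {K V : Type*} [Field K]
    [AddCommGroup V] [Module K V] [FiniteDimensional K V] {F G : Submodule K V} (h : F ≤ G)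
    (hG : finrank K G ≤ finrank K F + 1) {x : V} (hx : x ∈ G) (hxF : x ∉ F) :
    G = F ⊔ Submodule.span K {x} := by
  symm
  refine Submodule.eq_of_le_of_finrank_le
    (sup_le h ((Submodule.span_singleton_le_iff_mem x G).2 hx)) (hG.trans ?_)
  refine Nat.succ_le_of_lt (Submodule.finrank_lt_finrank_of_lt ?_)
  exact lt_of_le_of_ne le_sup_left fun h' => hxF (h' ▸
    Submodule.mem_sup_right (Submodule.mem_span_singleton_self x))

/-- At the first flag step whose intersection with H leaves G, one new vector x spans F (i + 1) over
F i. Hence [X, x] - c x lies in F i ∩ H, which is inside G; stability of G plays no role. -/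
theorem IsFlag.exists_eigenvector {n : ℕ} {F : ℕ → Submodule ℝ 𝔤} (hF : IsFlag 𝔱 n F)
    {G H : Submodule ℝ 𝔤} (hH : Stable 𝔱 H) (hGH : ¬ H ≤ G) :
    ∃ x ∈ H, x ∉ G ∧ ∀ X ∈ 𝔱, ∃ c : ℝ, ⁅X, x⁆ - c • x ∈ G := by
  classical
  have hex : ∃ i, ¬ F i ⊓ H ≤ G := ⟨n, by rwa [hF.top, top_inf_eq]⟩
  obtain ⟨i, hi⟩ : ∃ i, Nat.find hex = i + 1 := by
    refine Nat.exists_eq_succ_of_ne_zero fun h0 => ?_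
    have := Nat.find_spec hex
    rw [h0, hF.zero, bot_inf_eq] at this
    exact this bot_le
  have h1 := Nat.find_spec hex
  have h2 : F i ⊓ H ≤ G := not_not.1 (Nat.find_min hex (m := i) (by omega))
  rw [hi, SetLike.not_le_iff_exists] at h1
  obtain ⟨x, ⟨hxF, hxH⟩, hxG⟩ := h1
  refine ⟨x, hxH, hxG, fun X hX => ?_⟩
  have hmem : ⁅X, x⁆ ∈ F (i + 1) := hF.stable _ X hX x hxF
  rw [Submodule.eq_sup_span_singleton_of_finrank_le (hF.le_succ i) (hF.finrank_succ_le i) hxF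
    fun h => hxG (h2 ⟨h, hxH⟩)] at hmem
  obtain ⟨f, hf, y, hy, hfy⟩ := Submodule.mem_sup.1 hmem
  obtain ⟨c, rfl⟩ := Submodule.mem_span_singleton.1 hy
  refine ⟨c, ?_⟩
  rw [← hfy, add_sub_cancel_right]
  refine h2 ⟨hf, ?_⟩
  rw [eq_sub_of_add_eq hfy]
  exact sub_mem (hH X hX x hxH) (H.smul_mem c hxH)

theorem exists_isFlag (h : IsTriangular 𝔱) : ∃ n F, IsFlag 𝔱 n F := by
  obtain ⟨n, e, he⟩ := h
  refine ⟨n, fun i => Submodule.span ℝ (e '' {j : Fin n | (j : ℕ) < i}), ?_, ?_, ?_, ?_, ?_⟩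
  · simp
  · have : {j : Fin n | (j : ℕ) < n} = Set.univ := by ext j; simp
    rw [this, Set.image_univ, e.span_eq]
  · exact fun i => Submodule.span_mono (Set.image_mono fun j (hj : (j : ℕ) < i) =>
      show (j : ℕ) < i + 1 by omega)
  · intro i
    by_cases hi : i < n
    · have : {j : Fin n | (j : ℕ) < i + 1} = insert ⟨i, hi⟩ {j : Fin n | (j : ℕ) < i} := by
        ext j; simp [Fin.ext_iff]; omega
      rw [this, Set.image_insert_eq, Submodule.span_insert]
      refine (Submodule.finrank_add_le_finrank_add_finrank _ _).trans ?_
      have := finrank_span_le_card (R := ℝ) ({e ⟨i, hi⟩} : Set 𝔤)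
      rw [Set.toFinset_card, Set.card_singleton] at this
      omega
    · have : {j : Fin n | (j : ℕ) < i + 1} = {j : Fin n | (j : ℕ) < i} := by
        ext j; simp; omega
      rw [this]; exact Nat.le_succ _
  · intro i X hX y hy
    induction hy using Submodule.span_induction with
    | zero => simp
    | add x y _ _ hx hy => rw [lie_add]; exact add_mem hx hy
    | smul c x _ hx => rw [lie_smul]; exact Submodule.smul_mem _ c hx
    | mem y hy =>
      obtain ⟨j, hj, rfl⟩ := hy
      rw [e.mem_span_image]
      intro k hk
      by_contra hki
      have hkj : j < k := by
        have : (j : ℕ) < i := hj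
        have : ¬ (k : ℕ) < i := hki
        exact Fin.lt_def.2 (by omega)
      have := he X hX hkj
      rw [LinearMap.toMatrix_apply, LieAlgebra.ad_apply] at this
      exact (Finsupp.mem_support_iff.1 hk) this

/-- Lifts of eigenvectors, taken successively modulo the span of those already found, form the
triangularizing basis. -/
theorem isTriangular_of_exists_eigenvector
    (h : ∀ F : Submodule ℝ 𝔤, Stable 𝔱 F → F ≠ ⊤ →
      ∃ x ∉ F, ∀ X ∈ 𝔱, ∃ c : ℝ, ⁅X, x⁆ - c • x ∈ F) : IsTriangular 𝔱 := by
  have key : ∀ k ≤ finrank ℝ 𝔤, ∃ v : Fin k → 𝔤, LinearIndependent ℝ v ∧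
      ∀ i, ∀ X ∈ 𝔱, ⁅X, v i⁆ ∈ Submodule.span ℝ (v '' Set.Iic i) := by
    intro k hk
    induction k with
    | zero => exact ⟨Fin.elim0, linearIndependent_empty_type, fun i => i.elim0⟩
    | succ k ih =>
      obtain ⟨v, hv, hst⟩ := ih (by omega)
      set F := Submodule.span ℝ (Set.range v)
      have hF : Stable 𝔱 F := by
        intro X hX y hy
        induction hy using Submodule.span_induction with
        | zero => simp
        | add x y _ _ hx hy => rw [lie_add]; exact add_mem hx hy
        | smul c x _ hx => rw [lie_smul]; exact Submodule.smul_mem _ c hx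
        | mem y hy =>
          obtain ⟨i, rfl⟩ := hy
          exact Submodule.span_mono (Set.image_subset_range _ _) (hst i X hX)
      have hFtop : F ≠ ⊤ := by
        intro htop
        have h1 : finrank ℝ F = k := by
          simpa using finrank_span_eq_card hv
        rw [htop, finrank_top] at h1
        omega
      obtain ⟨x, hxF, hx⟩ := h F hF hFtop
      refine ⟨Fin.snoc v x, linearIndependent_finSnoc.2 ⟨hv, hxF⟩, fun i => ?_⟩
      have hsub : ∀ i : Fin k, v '' Set.Iic i ⊆
          (Fin.snoc v x : Fin (k + 1) → 𝔤) '' Set.Iic i.castSucc := by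
        rintro i _ ⟨j, hj, rfl⟩
        exact ⟨j.castSucc, Fin.castSucc_le_castSucc_iff.2 hj, by simp⟩
      have hsub' : Set.range v ⊆ (Fin.snoc v x : Fin (k + 1) → 𝔤) '' Set.Iic (Fin.last k) := by
        rintro _ ⟨j, rfl⟩
        exact ⟨j.castSucc, Fin.le_last _, by simp⟩
      induction i using Fin.lastCases with
      | last =>
        intro X hX
        obtain ⟨c, hc⟩ := hx X hX
        rw [Fin.snoc_last]
        have h1 := Submodule.span_mono hsub' hc
        have h2 : c • x ∈ Submodule.span ℝ
            ((Fin.snoc v x : Fin (k + 1) → 𝔤) '' Set.Iic (Fin.last k)) :=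
          Submodule.smul_mem _ c (Submodule.subset_span ⟨Fin.last k, Set.mem_Iic.2 le_rfl, by simp⟩)
        simpa using add_mem h1 h2
      | cast i =>
        intro X hX
        rw [Fin.snoc_castSucc]
        exact Submodule.span_mono (hsub i) (hst i X hX)
  obtain ⟨v, hv, hst⟩ := key _ le_rfl
  let e := basisOfLinearIndependentOfCardEqFinrank' v hv (by simp)
  have he : ⇑e = v := coe_basisOfLinearIndependentOfCardEqFinrank' v hv (by simp)
  refine ⟨finrank ℝ 𝔤, e, fun X hX i j hij => ?_⟩
  rw [LinearMap.toMatrix_apply, LieAlgebra.ad_apply, he]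
  have := hst j X hX
  rw [← he] at this ⊢
  rw [e.mem_span_image] at this
  by_contra hne
  have h1 := this (Finsupp.mem_support_iff.2 hne)
  exact absurd h1 (not_le.2 hij)

theorem isTriangular_of_isFlag {n : ℕ} {F : ℕ → Submodule ℝ 𝔤} (hF : IsFlag 𝔱 n F) :
    IsTriangular 𝔱 :=
  isTriangular_of_exists_eigenvector fun G _ hG => by
    obtain ⟨x, -, h⟩ := hF.exists_eigenvector (G := G) (H := ⊤)
      (fun _ _ _ _ => Submodule.mem_top) (fun h => hG (top_le_iff.1 h))
    exact ⟨x, h⟩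

theorem IsTriangular.exists_eigenvector (h : IsTriangular 𝔱)
    {G H : Submodule ℝ 𝔤} (hH : Stable 𝔱 H) (hGH : ¬ H ≤ G) :
    ∃ x ∈ H, x ∉ G ∧ ∀ X ∈ 𝔱, ∃ c : ℝ, ⁅X, x⁆ - c • x ∈ G := by
  obtain ⟨n, F, hF⟩ := exists_isFlag h
  exact hF.exists_eigenvector hH hGH

open Module.End in
/-- The eigenvalues of `ad T` are real if `T` belongs to a triangular subalgebra. -/
theorem IsTriangular.iSup_maxGenEigenspace_eq_top (h : IsTriangular 𝔱) {T : 𝔤} (hT : T ∈ 𝔱) :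
    ⨆ μ : ℝ, (LieAlgebra.ad ℝ 𝔤 T).maxGenEigenspace μ = ⊤ := by
  set f := LieAlgebra.ad ℝ 𝔤 T
  set W := ⨆ μ : ℝ, f.maxGenEigenspace μ
  have hW : ∀ x ∈ W, f x ∈ W := by
    suffices W ≤ W.comap f from this
    exact iSup_le fun μ x hx => Submodule.mem_iSup_of_mem μ
      (mapsTo_maxGenEigenspace_of_comm (Commute.refl f) μ hx)
  by_contra hne
  obtain ⟨n, F, hF⟩ := exists_isFlag h
  obtain ⟨x, -, hxW, hx⟩ := hF.exists_eigenvector (G := W) (H := ⊤)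
    (fun _ _ _ _ => Submodule.mem_top) (fun h => hne (top_le_iff.1 h))
  obtain ⟨c, hc⟩ := hx T hT
  set g : Module.End ℝ 𝔤 := f - algebraMap ℝ (Module.End ℝ 𝔤) c
  have hg : ∀ y, g y = f y - c • y := fun y => rfl
  have hgW : ∀ y ∈ W, g y ∈ W := fun y hy => by
    rw [hg]; exact sub_mem (hW y hy) (W.smul_mem c hy)
  -- Fitting decomposition of g = ad T - c: the kernel of g^k lies in W, and g is injective on the
  -- range of g^k.
  obtain ⟨k, hk, hk1⟩ :=
    (g.eventually_isCompl_ker_pow_range_pow.and (Filter.eventually_ge_atTop 1)).exists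
  have hker : LinearMap.ker (g ^ k) ≤ W := by
    intro y hy
    refine Submodule.mem_iSup_of_mem c ((mem_maxGenEigenspace _ _ _).2 ⟨k, ?_⟩)
    exact hy
  obtain ⟨a, ha, r, hr, har⟩ := Submodule.mem_sup.1
    (show x ∈ LinearMap.ker (g ^ k) ⊔ LinearMap.range (g ^ k) by
      rw [hk.sup_eq_top]; exact Submodule.mem_top)
  have hgR : ∀ y ∈ LinearMap.range (g ^ k), g y ∈ LinearMap.range (g ^ k) := by
    rintro _ ⟨y, rfl⟩
    exact ⟨g y, by rw [← Module.End.mul_apply, ← Module.End.mul_apply, ← pow_succ, ← pow_succ']⟩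
  have hinj : ∀ y ∈ LinearMap.range (g ^ k), g y = 0 → y = 0 := by
    intro y hy h0
    refine Submodule.disjoint_def.1 hk.disjoint y ?_ hy
    rw [LinearMap.mem_ker]
    obtain ⟨j, rfl⟩ := Nat.exists_eq_succ_of_ne_zero (Nat.one_le_iff_ne_zero.1 hk1)
    rw [pow_succ, Module.End.mul_apply, h0, map_zero]
  set Y := W ⊓ LinearMap.range (g ^ k)
  have hgY : ∀ y ∈ Y, g y ∈ Y := fun y hy => ⟨hgW y hy.1, hgR y hy.2⟩
  -- g is bijective on Y, so g r = g r' for some r' in Y. Injectivity on the range gives r = r',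
  -- which puts x in W.
  have hsurj : Function.Surjective (g.restrict hgY) := by
    rw [← LinearMap.injective_iff_surjective, injective_iff_map_eq_zero]
    exact fun y hy => Subtype.ext (hinj y y.2.2 (congrArg Subtype.val hy))
  have hgr : g r ∈ Y := by
    refine ⟨?_, hgR r hr⟩
    rw [show r = x - a by rw [← har, add_sub_cancel_left], map_sub]
    exact sub_mem hc (hgW a (hker ha))
  obtain ⟨r', hr'⟩ := hsurj ⟨g r, hgr⟩
  have hrr : r - r' = 0 := hinj _ (sub_mem hr r'.2.2) (by
    rw [map_sub, sub_eq_zero]; exact (congrArg Subtype.val hr').symm)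
  refine hxW ?_
  rw [← har, sub_eq_zero.1 hrr]
  exact add_mem (hker ha) r'.2.1

end Triangular

/-! ### Sums, degenerations and dimensions of triangular subalgebras -/

namespace Triangular

open CRAlg

variable {𝔤 : Type*} [LieRing 𝔤] [LieAlgebra ℝ 𝔤] {𝔱 𝔰 : LieSubalgebra ℝ 𝔤}

/-- The sum of a subalgebra and of a subalgebra normalized by it. -/
def sumOfNormalizes (h : ∀ X ∈ 𝔱, ∀ Y ∈ 𝔰, ⁅X, Y⁆ ∈ 𝔰) : LieSubalgebra ℝ 𝔤 where
  __ := 𝔱.toSubmodule ⊔ 𝔰.toSubmodule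
  lie_mem' := by
    intro x y hx hy
    obtain ⟨a, ha, b, hb, rfl⟩ := Submodule.mem_sup.1 hx
    obtain ⟨c, hc, d, hd, rfl⟩ := Submodule.mem_sup.1 hy
    rw [add_lie, lie_add, lie_add, add_assoc]
    refine Submodule.add_mem_sup (𝔱.lie_mem ha hc) (add_mem (h a ha d hd) (add_mem ?_ ?_))
    · rw [← lie_skew]; exact neg_mem (h c hc b hb)
    · exact 𝔰.lie_mem hb hd

theorem mem_sumOfNormalizes {h : ∀ X ∈ 𝔱, ∀ Y ∈ 𝔰, ⁅X, Y⁆ ∈ 𝔰} {x : 𝔤} :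
    x ∈ sumOfNormalizes h ↔ ∃ a ∈ 𝔱, ∃ b ∈ 𝔰, a + b = x := Submodule.mem_sup

theorem left_le_sumOfNormalizes (h : ∀ X ∈ 𝔱, ∀ Y ∈ 𝔰, ⁅X, Y⁆ ∈ 𝔰) : 𝔱 ≤ sumOfNormalizes h :=
  fun x hx => mem_sumOfNormalizes.2 ⟨x, hx, 0, 𝔰.zero_mem, add_zero x⟩

theorem right_le_sumOfNormalizes (h : ∀ X ∈ 𝔱, ∀ Y ∈ 𝔰, ⁅X, Y⁆ ∈ 𝔰) : 𝔰 ≤ sumOfNormalizes h :=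
  fun x hx => mem_sumOfNormalizes.2 ⟨0, 𝔱.zero_mem, x, hx, zero_add x⟩

variable [FiniteDimensional ℝ 𝔤]

/-- The invariance lemma behind Lie's theorem in characteristic zero, applied to the ideal 𝔰 of 𝔯
acting on 𝔤/F. -/
theorem stable_setOf_eigenvector {𝔯 : LieSubalgebra ℝ 𝔤} (hsr : 𝔰 ≤ 𝔯)
    (hn : ∀ X ∈ 𝔯, ∀ Y ∈ 𝔰, ⁅X, Y⁆ ∈ 𝔰) {F : Submodule ℝ 𝔤} (hF : Stable 𝔯 F) (χ : 𝔤 → ℝ) :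
    ∃ G : Submodule ℝ 𝔤, Stable 𝔯 G ∧ ∀ y, y ∈ G ↔ ∀ S ∈ 𝔰, ⁅S, y⁆ - χ S • y ∈ F := by
  let A : LieIdeal ℝ 𝔯 :=
    { __ := 𝔰.toSubmodule.comap 𝔯.toSubmodule.subtype
      lie_mem := fun {x m} hm => hn x x.2 m hm }
  let F' : LieSubmodule ℝ 𝔯 𝔤 := { __ := F, lie_mem := fun {x m} hm => hF x x.2 m hm }
  let χ' : A → ℝ := fun a => χ a.1
  let W : LieSubmodule ℝ 𝔯 (𝔤 ⧸ F') := LieModule.weightSpaceOfIsLieTower ℝ (𝔤 ⧸ F') χ'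
  have hW : ∀ y : 𝔤, (LieSubmodule.Quotient.mk' F' y) ∈ W ↔ ∀ S ∈ 𝔰, ⁅S, y⁆ - χ S • y ∈ F := by
    intro y
    have h1 : (LieSubmodule.Quotient.mk' F' y) ∈ W ↔
        ∀ a : A, ⁅a, LieSubmodule.Quotient.mk' F' y⁆ = χ' a • LieSubmodule.Quotient.mk' F' y :=
      LieModule.mem_weightSpace _ _
    have h2 : ∀ a : A, (⁅a, LieSubmodule.Quotient.mk' F' y⁆ =
        χ' a • LieSubmodule.Quotient.mk' F' y) ↔ ⁅(a.1 : 𝔤), y⁆ - χ a.1 • y ∈ F := by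
      intro a
      have e : ⁅a, LieSubmodule.Quotient.mk' F' y⁆ =
        LieSubmodule.Quotient.mk' F' ⁅(a.1 : 𝔤), y⁆ := rfl
      rw [e, ← map_smul, ← sub_eq_zero, ← map_sub]
      exact LieSubmodule.Quotient.mk_eq_zero F'
    rw [h1]
    refine ⟨fun h S hS => (h2 ⟨⟨S, hsr hS⟩, hS⟩).1 (h _), fun h a => (h2 a).2 (h _ a.2)⟩
  refine ⟨W.toSubmodule.comap (LieSubmodule.Quotient.mk' F' : 𝔤 →ₗ[ℝ] 𝔤 ⧸ F'), ?_, hW⟩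
  intro X hX y hy
  exact W.lie_mem (x := ⟨X, hX⟩) hy

/-- As in Lie's theorem: the vectors of a fixed 𝔰-weight modulo F form a stable space G not
contained in F, and a flag for 𝔱 provides an eigenvector of 𝔱 inside G. -/
theorem isTriangular_sumOfNormalizes (ht : IsTriangular 𝔱) (hs : IsTriangular 𝔰)
    (h : ∀ X ∈ 𝔱, ∀ Y ∈ 𝔰, ⁅X, Y⁆ ∈ 𝔰) : IsTriangular (sumOfNormalizes h) := by
  refine isTriangular_of_exists_eigenvector fun F hF hFtop => ?_
  have htop : ∀ 𝔲 : LieSubalgebra ℝ 𝔤, Stable 𝔲 ⊤ := fun _ _ _ _ _ => Submodule.mem_top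
  obtain ⟨x, -, hxF, hx⟩ := IsTriangular.exists_eigenvector hs (htop _) (fun h => hFtop (top_le_iff.1 h))
  choose! χ hχ using hx
  have hn : ∀ X ∈ sumOfNormalizes h, ∀ Y ∈ 𝔰, ⁅X, Y⁆ ∈ 𝔰 := by
    intro X hX Y hY
    obtain ⟨a, ha, b, hb, rfl⟩ := mem_sumOfNormalizes.1 hX
    rw [add_lie]
    exact add_mem (h a ha Y hY) (𝔰.lie_mem hb hY)
  obtain ⟨G, hG, hGmem⟩ := stable_setOf_eigenvector (right_le_sumOfNormalizes h) hn hF χ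
  obtain ⟨y, hyG, hyF, hy⟩ := IsTriangular.exists_eigenvector ht (G := F) (H := G)
    (fun X hX => hG X (left_le_sumOfNormalizes h hX)) fun h => hxF (h ((hGmem x).2 hχ))
  refine ⟨y, hyF, fun X hX => ?_⟩
  obtain ⟨a, ha, b, hb, rfl⟩ := mem_sumOfNormalizes.1 hX
  obtain ⟨c, hc⟩ := hy a ha
  refine ⟨c + χ b, ?_⟩
  have := add_mem hc ((hGmem y).1 hyG b hb)
  rwa [show ⁅a, y⁆ - c • y + (⁅b, y⁆ - χ b • y) = ⁅a + b, y⁆ - (c + χ b) • y by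
    rw [add_lie, add_smul]; abel] at this

/-- A degeneration of a triangular subalgebra is triangular. -/
theorem exists_isTriangular_of_degeneration {D : Submodule ℝ 𝔤 → Submodule ℝ 𝔤} (hmono : Monotone D)
    (hrank : ∀ U, finrank ℝ (D U) = finrank ℝ U)
    (hlie : ∀ U₁ U₂ U₃ : Submodule ℝ 𝔤, (∀ x ∈ U₁, ∀ y ∈ U₂, ⁅x, y⁆ ∈ U₃) →
        ∀ x ∈ D U₁, ∀ y ∈ D U₂, ⁅x, y⁆ ∈ D U₃) (ht : IsTriangular 𝔱) :
    ∃ 𝔱' : LieSubalgebra ℝ 𝔤, 𝔱'.toSubmodule = D 𝔱.toSubmodule ∧ IsTriangular 𝔱' := by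
  obtain ⟨n, F, hF⟩ := exists_isFlag ht
  let 𝔱' : LieSubalgebra ℝ 𝔤 :=
    { __ := D 𝔱.toSubmodule
      lie_mem' := fun {x y} hx hy =>
        hlie _ _ _ (fun x hx y hy => 𝔱.lie_mem hx hy) x hx y hy }
  refine ⟨𝔱', rfl, ?_⟩
  refine isTriangular_of_isFlag (n := n) (F := fun i => D (F i)) ⟨?_, ?_, ?_, ?_, ?_⟩
  · rw [hF.zero, ← Submodule.finrank_eq_zero (R := ℝ), hrank, finrank_bot]
  · rw [hF.top]
    refine Submodule.eq_top_of_finrank_eq ?_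
    rw [hrank, finrank_top]
  · exact fun i => hmono (hF.le_succ i)
  · intro i
    rw [hrank, hrank]
    exact hF.finrank_succ_le i
  · exact fun i X hX y hy => hlie _ _ _ (hF.stable i) X hX y hy

/-- A maximal triangular subalgebra has the maximal dimension among triangular subalgebras. -/
theorem finrank_le_of_maximal (ht : Maximal IsTriangular 𝔱) (hs : IsTriangular 𝔰) :
    finrank ℝ 𝔰 ≤ finrank ℝ 𝔱 := by
  obtain ⟨n, F, hF⟩ := exists_isFlag ht.prop
  -- Successive degenerations, one for each flag step that meets 𝔱 in something new, replace 𝔰 by a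
  -- triangular subalgebra of the same dimension normalized by ever larger parts of 𝔱.
  have key : ∀ i, ∃ 𝔰' : LieSubalgebra ℝ 𝔤, IsTriangular 𝔰' ∧ finrank ℝ 𝔰' = finrank ℝ 𝔰 ∧
      ∀ X ∈ 𝔱, X ∈ F i → ∀ Y ∈ 𝔰', ⁅X, Y⁆ ∈ 𝔰' := by
    intro i
    induction i with
    | zero =>
      refine ⟨𝔰, hs, rfl, fun X _ hX Y _ => ?_⟩
      rw [hF.zero, Submodule.mem_bot] at hX
      rw [hX, zero_lie]
      exact 𝔰.zero_mem
    | succ i ih =>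
      obtain ⟨𝔰', hs', hr', hn'⟩ := ih
      by_cases hT : ∃ T ∈ 𝔱, T ∈ F (i + 1) ∧ T ∉ F i
      · obtain ⟨T, hT, hTF, hTF'⟩ := hT
        obtain ⟨D, hmono, hrank, hlie, hstab, hfix⟩ :=
          exists_degeneration (IsTriangular.iSup_maxGenEigenspace_eq_top ht.prop hT)
        obtain ⟨𝔰'', h'', hs''⟩ := exists_isTriangular_of_degeneration hmono hrank hlie hs'
        refine ⟨𝔰'', hs'', ?_, fun X hX hXF Y hY => ?_⟩
        · rw [← hr']
          have := hrank 𝔰'.toSubmodule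
          rw [← h''] at this
          exact this
        · rw [Submodule.eq_sup_span_singleton_of_finrank_le (hF.le_succ i) (hF.finrank_succ_le i)
            hTF hTF'] at hXF
          obtain ⟨f, hf, y, hy, rfl⟩ := Submodule.mem_sup.1 hXF
          obtain ⟨c, rfl⟩ := Submodule.mem_span_singleton.1 hy
          have hft : f ∈ 𝔱 := by simpa using sub_mem hX (𝔱.smul_mem c hT)
          -- The part of 𝔱 already normalizing is ad T-invariant, hence fixed by D, so it still
          -- normalizes the degenerated subalgebra; T itself does by construction.
          have hfix' : D (𝔱.toSubmodule ⊓ F i) = 𝔱.toSubmodule ⊓ F i :=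
            hfix _ fun x hx => ⟨𝔱.lie_mem hT hx.1, hF.stable i T hT x hx.2⟩
          have hY' : Y ∈ D 𝔰'.toSubmodule := h'' ▸ hY
          have h1 := hlie (𝔱.toSubmodule ⊓ F i) 𝔰'.toSubmodule 𝔰'.toSubmodule
            (fun x hx y hy => hn' x hx.1 hx.2 y hy) f (hfix'.symm ▸ ⟨hft, hf⟩) Y hY'
          have h2 := hstab 𝔰'.toSubmodule Y hY'
          rw [← h''] at h1 h2
          rw [add_lie, smul_lie]
          exact add_mem h1 (𝔰''.smul_mem c h2)
      · push Not at hT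
        exact ⟨𝔰', hs', hr', fun X hX hXF => hn' X hX (hT X hX hXF)⟩
  obtain ⟨𝔰', hs', hr', hn'⟩ := key n
  have hn : ∀ X ∈ 𝔱, ∀ Y ∈ 𝔰', ⁅X, Y⁆ ∈ 𝔰' := fun X hX =>
    hn' X hX (by rw [hF.top]; exact Submodule.mem_top)
  -- Now 𝔱 + 𝔰' is a triangular subalgebra, so maximality of 𝔱 absorbs 𝔰'.
  have hle : 𝔰' ≤ 𝔱 := (right_le_sumOfNormalizes hn).trans
    (ht.le_of_ge (isTriangular_sumOfNormalizes ht.prop hs' hn) (left_le_sumOfNormalizes hn))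
  rw [← hr']
  exact Submodule.finrank_mono (s := 𝔰'.toSubmodule) (t := 𝔱.toSubmodule) hle

end Triangular

/-! ### The Killing form and the grading by a real diagonalizable element -/

namespace Triangular

open CRAlg

variable {𝔤 : Type*} [LieRing 𝔤] [LieAlgebra ℝ 𝔤] {𝔱 : LieSubalgebra ℝ 𝔤}

theorem _root_.Matrix.BlockTriangular.mul_apply_diag {R : Type*} [CommRing R] {n : ℕ}
    {A B : Matrix (Fin n) (Fin n) R}
    (hA : A.BlockTriangular id) (hB : B.BlockTriangular id) (i : Fin n) :
    (A * B) i i = A i i * B i i := by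
  rw [Matrix.mul_apply, Finset.sum_eq_single i]
  · intro j _ hj
    rcases lt_or_gt_of_ne hj with h | h
    · rw [hA h, zero_mul]
    · rw [hB h, mul_zero]
  · simp

/-- The Killing form of `𝔤` vanishes on `[𝔱, 𝔱] × 𝔱` if `𝔱` is triangular. -/
theorem killingForm_lie_eq_zero (h : IsTriangular 𝔱) {u v w : 𝔤} (hu : u ∈ 𝔱) (hv : v ∈ 𝔱)
    (hw : w ∈ 𝔱) : killingForm ℝ 𝔤 ⁅u, v⁆ w = 0 := by
  obtain ⟨n, e, he⟩ := h
  rw [LieModule.traceForm_apply_apply, LinearMap.trace_eq_matrix_trace ℝ e, LinearMap.toMatrix_comp e e e]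
  have huv : (LinearMap.toMatrix e e) (LieModule.toEnd ℝ 𝔤 𝔤 ⁅u, v⁆) =
      LinearMap.toMatrix e e (LieAlgebra.ad ℝ 𝔤 u) * LinearMap.toMatrix e e (LieAlgebra.ad ℝ 𝔤 v) -
      LinearMap.toMatrix e e (LieAlgebra.ad ℝ 𝔤 v) *
        LinearMap.toMatrix e e (LieAlgebra.ad ℝ 𝔤 u) := by
    rw [← LinearMap.toMatrix_comp, ← LinearMap.toMatrix_comp, ← map_sub]
    congr 1
    ext x
    simp
  have hd := (he _ (𝔱.lie_mem hu hv))
  refine Finset.sum_eq_zero fun i _ => ?_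
  rw [Matrix.diag_apply]
  refine (hd.mul_apply_diag (he w hw) i).trans ?_
  have : (LinearMap.toMatrix e e) (LieAlgebra.ad ℝ 𝔤 ⁅u, v⁆) i i = 0 := by
    refine (congrFun (congrFun huv i) i).trans ?_
    rw [Matrix.sub_apply, (he u hu).mul_apply_diag (he v hv), (he v hv).mul_apply_diag (he u hu),
      mul_comm, sub_self]
  rw [this, zero_mul]

section Grading

variable (H : 𝔤)

/-- The eigenspaces of `ad H`. -/
abbrev eig (c : ℝ) : Submodule ℝ 𝔤 := (LieAlgebra.ad ℝ 𝔤 H).eigenspace c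

variable {H}

theorem mem_eig {c : ℝ} {x : 𝔤} : x ∈ eig H c ↔ ⁅H, x⁆ = c • x := by
  rw [eig, Module.End.mem_eigenspace_iff, LieAlgebra.ad_apply]

theorem lie_mem_eig {c d : ℝ} {x y : 𝔤} (hx : x ∈ eig H c) (hy : y ∈ eig H d) :
    ⁅x, y⁆ ∈ eig H (c + d) := by
  rw [mem_eig] at *
  rw [leibniz_lie, hx, hy, smul_lie, lie_smul, add_smul]

theorem killingForm_eig {c d : ℝ} (hcd : c + d ≠ 0) {x y : 𝔤} (hx : x ∈ eig H c)
    (hy : y ∈ eig H d) : killingForm ℝ 𝔤 x y = 0 := by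
  rw [mem_eig] at *
  have h := LieModule.traceForm_apply_lie_apply ℝ 𝔤 𝔤 x H y
  rw [← lie_skew, hx, hy] at h
  simp only [map_neg, map_smul, LinearMap.neg_apply, LinearMap.smul_apply, smul_eq_mul] at h
  have : (c + d) * killingForm ℝ 𝔤 x y = 0 := by
    rw [add_mul]; rw [killingForm]; linarith
  exact (mul_eq_zero.1 this).resolve_left hcd

theorem lie_mem_iSup_eig {p q r : ℝ → Prop} (hpq : ∀ c d, p c → q d → r (c + d)) {x y : 𝔤}
    (hx : x ∈ ⨆ (c) (_ : p c), eig H c) (hy : y ∈ ⨆ (c) (_ : q c), eig H c) :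
    ⁅x, y⁆ ∈ ⨆ (c) (_ : r c), eig H c := by
  suffices (⨆ (c) (_ : p c), eig H c) ≤
      (⨆ (c) (_ : r c), eig H c).comap ((lieBilin 𝔤).flip y) from this hx
  refine iSup₂_le fun c hc x hx => ?_
  suffices (⨆ (c) (_ : q c), eig H c) ≤
      (⨆ (c) (_ : r c), eig H c).comap (lieBilin 𝔤 x) from this hy
  exact iSup₂_le fun d hd y hy =>
    Submodule.mem_iSup_of_mem _ (Submodule.mem_iSup_of_mem (hpq c d hc hd) (lie_mem_eig hx hy))

variable (H) in
/-- The subalgebra spanned by the eigenspaces of `ad H` for positive eigenvalues. -/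
def positivePart : LieSubalgebra ℝ 𝔤 where
  __ := ⨆ (c : ℝ) (_ : 0 < c), eig H c
  lie_mem' {_ _} hx hy := lie_mem_iSup_eig (fun _ _ hc hd => add_pos hc hd) hx hy

theorem iSup_maxGenEigenspace_eq_top_of_eig (hH : ⨆ c, eig H c = ⊤) :
    ⨆ μ : ℝ, (LieAlgebra.ad ℝ 𝔤 H).maxGenEigenspace μ = ⊤ :=
  top_le_iff.1 (hH ▸ iSup_mono fun _ => Module.End.eigenspace_le_maxGenEigenspace)

/-- Eigenspaces pair nontrivially only for opposite eigenvalues, so a vector of the negative part is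
automatically orthogonal to the nonpositive part; nondegeneracy does the rest. -/
theorem eq_zero_of_forall_killingForm_positivePart [LieAlgebra.IsKilling ℝ 𝔤]
    (hH : ⨆ c, eig H c = ⊤) {x : 𝔤}
    (hx : x ∈ ⨆ (c : ℝ) (_ : c < 0), eig H c) (h : ∀ y ∈ positivePart H, killingForm ℝ 𝔤 x y = 0) :
    x = 0 := by
  have hle : (⊤ : Submodule ℝ 𝔤) ≤ LinearMap.ker (killingForm ℝ 𝔤 x) := by
    rw [← hH]
    refine iSup_le fun d => ?_
    by_cases hd : 0 < d
    · exact fun y hy => h y (Submodule.mem_iSup_of_mem d (Submodule.mem_iSup_of_mem hd hy))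
    · intro y hy
      suffices (⨆ (c : ℝ) (_ : c < 0), eig H c) ≤
        LinearMap.ker ((killingForm ℝ 𝔤).flip y) from this hx
      exact iSup₂_le fun c hc x hx => killingForm_eig (by linarith [not_lt.1 hd]) hx hy
  have hker : x ∈ LinearMap.ker (killingForm ℝ 𝔤) :=
    LinearMap.mem_ker.2 (LinearMap.ext fun y => hle Submodule.mem_top)
  rwa [LieAlgebra.IsKilling.ker_killingForm_eq_bot, Submodule.mem_bot] at hker

variable [FiniteDimensional ℝ 𝔤]

/-- Positive elements raise the eigenvalue. A vector outside F in the highest eigenspace not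
contained in F is therefore killed modulo F. -/
theorem isTriangular_positivePart (hH : ⨆ c, eig H c = ⊤) : IsTriangular (positivePart H) := by
  refine isTriangular_of_exists_eigenvector fun F _ hF => ?_
  have hfin : {c | ¬ eig H c ≤ F}.Finite := by
    refine (WellFoundedGT.finite_ne_bot_of_iSupIndep
      (Module.End.eigenspaces_iSupIndep (LieAlgebra.ad ℝ 𝔤 H))).subset fun c hc h => hc ?_
    exact (le_of_eq h).trans bot_le
  have hne : {c | ¬ eig H c ≤ F}.Nonempty := by
    by_contra hempty
    refine hF (top_le_iff.1 (hH ▸ iSup_le fun c => ?_))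
    by_contra hc
    exact hempty ⟨c, hc⟩
  obtain ⟨c, hc, hmax⟩ := hfin.exists_maximal hne
  obtain ⟨x, hx, hxF⟩ := SetLike.not_le_iff_exists.1 hc
  refine ⟨x, hxF, fun X hX => ⟨0, ?_⟩⟩
  rw [zero_smul, sub_zero]
  have h1 := lie_mem_iSup_eig (H := H) (p := fun d => 0 < d) (q := fun d => d = c)
    (r := fun d => c < d) (fun a b ha hb => by subst hb; linarith) hX (y := x)
    (Submodule.mem_iSup_of_mem c (Submodule.mem_iSup_of_mem rfl hx))
  refine (iSup₂_le fun d hd => ?_ : (⨆ (d) (_ : c < d), eig H d) ≤ F) h1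
  by_contra hd'
  exact absurd (hmax hd' hd.le) (not_le.2 hd)

variable (H) in
/-- The line spanned by `H`. -/
def line : LieSubalgebra ℝ 𝔤 where
  __ := Submodule.span ℝ {H}
  lie_mem' {x y} hx hy := by
    obtain ⟨a, rfl⟩ := Submodule.mem_span_singleton.1 hx
    obtain ⟨b, rfl⟩ := Submodule.mem_span_singleton.1 hy
    rw [smul_lie, lie_smul, lie_self, smul_zero, smul_zero]
    exact Submodule.zero_mem _

theorem isTriangular_line (hH : ⨆ c, eig H c = ⊤) : IsTriangular (line H) := by
  refine isTriangular_of_exists_eigenvector fun F _ hF => ?_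
  obtain ⟨c, hc⟩ : ∃ c, ¬ eig H c ≤ F := by
    by_contra! hle
    exact hF (top_le_iff.1 (hH ▸ iSup_le hle))
  obtain ⟨x, hx, hxF⟩ := SetLike.not_le_iff_exists.1 hc
  refine ⟨x, hxF, fun X hX => ?_⟩
  obtain ⟨a, rfl⟩ := Submodule.mem_span_singleton.1 hX
  refine ⟨a * c, ?_⟩
  rw [smul_lie, mem_eig.1 hx, smul_smul, sub_self]
  exact F.zero_mem

/-- If `𝔦` contains a maximal triangular subalgebra and is invariant under a real semisimple `H`,
then no `ad H`-eigenvector with negative eigenvalue, outside `𝔦`, is orthogonal to `𝔦`. -/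
theorem mem_of_killingForm_eq_zero [LieAlgebra.IsKilling ℝ 𝔤] (ht : Maximal IsTriangular 𝔱)
    {I : Submodule ℝ 𝔤} (hI : 𝔱.toSubmodule ≤ I) (hH : ⨆ c, eig H c = ⊤)
    (hHI : ∀ x ∈ I, ⁅H, x⁆ ∈ I) {c : ℝ} (hc : c < 0) {X : 𝔤} (hX : X ∈ eig H c)
    (hXI : ∀ y ∈ I, killingForm ℝ 𝔤 X y = 0) : X ∈ I := by
  by_contra hXmem
  obtain ⟨D, hmono, hrank, hlie, hstab, hfix⟩ :=
    exists_degeneration (iSup_maxGenEigenspace_eq_top_of_eig hH)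
  obtain ⟨𝔲, hu, hut⟩ := exists_isTriangular_of_degeneration hmono hrank hlie ht.prop
  have hmax : ∀ 𝔰 : LieSubalgebra ℝ 𝔤, IsTriangular 𝔰 → finrank ℝ 𝔰 ≤ finrank ℝ 𝔲 := by
    intro 𝔰 hs
    refine (finrank_le_of_maximal ht hs).trans (le_of_eq ?_)
    have := hrank 𝔱.toSubmodule
    rw [← hu] at this
    exact this.symm
  have huI : 𝔲.toSubmodule ≤ I := by
    rw [hu, ← hfix I hHI]
    exact hmono hI
  have huH : ∀ x ∈ 𝔲, ⁅H, x⁆ ∈ 𝔲 := by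
    intro x hx
    have := hstab 𝔱.toSubmodule x (hu ▸ hx)
    rwa [← hu] at this
  -- H normalizes 𝔲, so 𝔲 + ⟨H⟩ is triangular; 𝔲 already has the largest dimension.
  have hHu : H ∈ 𝔲 := by
    have hn : ∀ x ∈ line H, ∀ y ∈ 𝔲, ⁅x, y⁆ ∈ 𝔲 := by
      intro x hx y hy
      obtain ⟨a, rfl⟩ := Submodule.mem_span_singleton.1 hx
      rw [smul_lie]
      exact 𝔲.smul_mem a (huH y hy)
    have h1 := hmax _ (isTriangular_sumOfNormalizes (isTriangular_line hH) hut hn)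
    have h2 := Submodule.eq_of_le_of_finrank_le
      (S₁ := 𝔲.toSubmodule) (S₂ := (sumOfNormalizes hn).toSubmodule)
      (right_le_sumOfNormalizes hn) h1
    change H ∈ 𝔲.toSubmodule
    rw [h2]
    exact left_le_sumOfNormalizes hn (Submodule.mem_span_singleton_self H)
  set P : Submodule ℝ 𝔤 := (positivePart H).toSubmodule
  set M : Submodule ℝ 𝔤 := ⨆ (c : ℝ) (_ : c < 0), eig H c
  set uP : Submodule ℝ 𝔤 := ⨆ (c : ℝ) (_ : 0 < c), 𝔲.toSubmodule ⊓ eig H c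
  set uM : Submodule ℝ 𝔤 := ⨆ (c : ℝ) (_ : c < 0), 𝔲.toSubmodule ⊓ eig H c
  set uZ : Submodule ℝ 𝔤 := 𝔲.toSubmodule ⊓ eig H 0
  have hdecomp : 𝔲.toSubmodule ≤ uM ⊔ uZ ⊔ uP := by
    have h := Submodule.inf_iSup_genEigenspace (f := LieAlgebra.ad ℝ 𝔤 H) (p := 𝔲.toSubmodule)
      huH 1
    have hH' : ⨆ μ, (LieAlgebra.ad ℝ 𝔤 H).genEigenspace μ 1 = ⊤ := hH
    rw [hH', inf_top_eq] at h
    rw [h]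
    refine iSup_le fun c => ?_
    rcases lt_trichotomy c 0 with h | rfl | h
    · exact le_sup_of_le_left (le_sup_of_le_left (le_iSup₂_of_le c h le_rfl))
    · exact le_sup_of_le_left le_sup_right
    · exact le_sup_of_le_right (le_iSup₂_of_le c h le_rfl)
  have hdim : finrank ℝ 𝔲 ≤ finrank ℝ uM + finrank ℝ uZ + finrank ℝ uP := by
    have h1 := Submodule.finrank_mono hdecomp
    have h2 := Submodule.finrank_add_le_finrank_add_finrank (uM ⊔ uZ) uP
    have h3 := Submodule.finrank_add_le_finrank_add_finrank uM uZ
    exact h1.trans (h2.trans (Nat.add_le_add_right h3 _))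
  -- The competitor 𝔲₀ + P is triangular because 𝔲₀ preserves the grading and so normalizes P.
  have hZP : finrank ℝ uZ + finrank ℝ P ≤ finrank ℝ 𝔲 := by
    let 𝔷 : LieSubalgebra ℝ 𝔤 :=
      { __ := uZ
        lie_mem' := fun {x y} hx hy => ⟨𝔲.lie_mem hx.1 hy.1, by
          have := lie_mem_eig hx.2 hy.2
          rwa [add_zero] at this⟩ }
    have hn : ∀ x ∈ 𝔷, ∀ y ∈ positivePart H, ⁅x, y⁆ ∈ positivePart H := by
      intro x hx y hy
      exact lie_mem_iSup_eig (H := H) (p := fun d => d = 0) (q := fun d => 0 < d)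
        (r := fun d => 0 < d) (fun a b ha hb => by rw [ha, zero_add]; exact hb)
        (Submodule.mem_iSup_of_mem 0 (Submodule.mem_iSup_of_mem rfl hx.2)) hy
    have h𝔷 : 𝔷 ≤ 𝔲 := fun x hx => hx.1
    have h1 := hmax _ (isTriangular_sumOfNormalizes (IsTriangular.mono hut h𝔷)
      (isTriangular_positivePart hH) hn)
    have h2 := Submodule.finrank_sup_add_finrank_inf_eq uZ P
    have hdis : Disjoint uZ P := by
      refine ((Module.End.eigenspaces_iSupIndep (LieAlgebra.ad ℝ 𝔤 H)) 0).mono inf_le_right ?_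
      exact iSup₂_mono' fun d hd => ⟨d, hd.ne', le_rfl⟩
    rw [hdis.eq_bot, finrank_bot, add_zero] at h2
    rw [← h2]
    exact h1
  have huMu : uM ≤ 𝔲.toSubmodule := iSup₂_le fun _ _ => inf_le_left
  have huPu : uP ≤ 𝔲.toSubmodule := iSup₂_le fun _ _ => inf_le_left
  -- Since H lies in 𝔲, an eigenvector x of 𝔲 with eigenvalue d ≠ 0 equals [H, x]/d, and [𝔲, 𝔲] is
  -- orthogonal to 𝔲.
  have hperp : ∀ x ∈ uM, ∀ y ∈ uP, killingForm ℝ 𝔤 x y = 0 := by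
    intro x hx y hy
    suffices uM ≤ LinearMap.ker ((killingForm ℝ 𝔤).flip y) from this hx
    refine iSup₂_le fun d hd x hx => ?_
    have h1 := killingForm_lie_eq_zero hut hHu hx.1 (huPu hy)
    rw [mem_eig.1 hx.2, map_smul, LinearMap.smul_apply, smul_eq_mul] at h1
    exact (mul_eq_zero.1 h1).resolve_left hd.ne
  set R : Submodule ℝ 𝔤 := uM ⊔ Submodule.span ℝ {X}
  have hRM : R ≤ M := sup_le (iSup₂_mono fun _ _ => inf_le_right)
    ((Submodule.span_singleton_le_iff_mem X M).2
      (Submodule.mem_iSup_of_mem c (Submodule.mem_iSup_of_mem hc hX)))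
  have hRfin : finrank ℝ uM + 1 ≤ finrank ℝ R := by
    refine Nat.succ_le_of_lt (Submodule.finrank_lt_finrank_of_lt ?_)
    exact lt_of_le_of_ne le_sup_left fun h' => hXmem (huI (huMu (h' ▸
      Submodule.mem_sup_right (Submodule.mem_span_singleton_self X))))
  have hRperp : ∀ x ∈ R, ∀ y ∈ uP, killingForm ℝ 𝔤 x y = 0 := by
    intro x hx y hy
    obtain ⟨m, hm, z, hz, rfl⟩ := Submodule.mem_sup.1 hx
    obtain ⟨a, rfl⟩ := Submodule.mem_span_singleton.1 hz
    rw [map_add, map_smul, LinearMap.add_apply, LinearMap.smul_apply, hperp m hm y hy,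
      hXI y (huI (huPu hy)), smul_zero, add_zero]
  -- R lies in the negative part, so the Killing form embeds it into the dual of P; its image
  -- annihilates 𝔲₊.
  have hRP : finrank ℝ R + finrank ℝ uP ≤ finrank ℝ P := by
    have huPP : uP ≤ P := iSup₂_mono fun _ _ => inf_le_right
    let W : Submodule ℝ P := uP.comap P.subtype
    have hW : finrank ℝ W = finrank ℝ uP := (Submodule.comapSubtypeEquivOfLe huPP).finrank_eq
    let f : R →ₗ[ℝ] W.dualAnnihilator :=
      ((P.subtype.dualMap ∘ₗ killingForm ℝ 𝔤) ∘ₗ R.subtype).codRestrict _ fun x =>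
        (Submodule.mem_dualAnnihilator _).2 fun y hy => hRperp x x.2 y hy
    have hf : Function.Injective f := by
      rw [injective_iff_map_eq_zero]
      intro x hx
      refine Subtype.ext (eq_zero_of_forall_killingForm_positivePart hH (hRM x.2) fun y hy => ?_)
      exact LinearMap.congr_fun (congrArg Subtype.val hx) (⟨y, hy⟩ : P)
    have h1 := LinearMap.finrank_le_finrank_of_injective hf
    have h2 := Subspace.finrank_add_finrank_dualAnnihilator_eq W
    omega
  -- `hdim` and `hZP` give dim P ≤ dim 𝔲₋ + dim 𝔲₊, while `hRfin` and `hRP` give dim 𝔲₋ + 1 + dim 𝔲₊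
  -- ≤ dim P.
  omega

end Grading

end Triangular

/-! ### Brackets of root spaces -/

namespace LieAlgebra.IsKilling

open LieModule

variable {K L : Type*} [Field K] [CharZero K] [LieRing L] [LieAlgebra K L]
  [IsKilling K L] [FiniteDimensional K L]
  {H : LieSubalgebra K L} [H.IsCartanSubalgebra] [IsTriangularizable K H L]

theorem exists_smul_eq_of_mem_rootSpace {α : Weight K H L} (hα : α.IsNonZero) {x y : L}
    (hx : x ∈ rootSpace H α) (hx0 : x ≠ 0) (hy : y ∈ rootSpace H α) : ∃ c : K, c • x = y := by
  have h1 := finrank_rootSpace_eq_one α hα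
  obtain ⟨c, hc⟩ := (finrank_eq_one_iff_of_nonzero' (⟨x, hx⟩ : rootSpace H α)
    (fun h => hx0 (congrArg Subtype.val h))).1 h1 ⟨y, hy⟩
  exact ⟨c, congrArg Subtype.val hc⟩

/-- The bracket of two root spaces is nonzero if the sum of the roots is a weight. -/
theorem lie_ne_zero_of_mem_rootSpace {α β : Weight K H L} (hα : α.IsNonZero) (hβ : β.IsNonZero)
    (hαβ : rootSpace H (α + β : H → K) ≠ ⊥) {x y : L} (hx : x ∈ rootSpace H α) (hx0 : x ≠ 0)
    (hy : y ∈ rootSpace H β) (hy0 : y ≠ 0) : ⁅x, y⁆ ≠ 0 := by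
  -- v is a highest weight vector of the α-string through β; since α + β is a weight, β lies m + 1 ≥
  -- 1 steps below the top.
  obtain ⟨v, hv, hv0⟩ := (chainTop α β).exists_ne_zero
  obtain ⟨h, e, f, isSl2, he, hf⟩ := exists_isSl2Triple_of_weight_isNonZero hα
  obtain rfl := isSl2.h_eq_coroot hα he hf
  have prim : isSl2.HasPrimitiveVectorWith v (chainLength α β : K) :=
    have := lie_mem_genWeightSpace_of_mem_genWeightSpace he hv
    ⟨hv0, (chainLength_smul _ _ hv).symm, by rwa [genWeightSpace_add_chainTop _ _ hα] at this⟩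
  have hm : 1 ≤ chainTopCoeff α β := by
    have h := (rootSpace_zsmul_add_ne_bot_iff α β hα 1).1 (by rwa [one_smul])
    exact_mod_cast h.1
  obtain ⟨m, hm'⟩ : ∃ m, chainTopCoeff α β = m + 1 := ⟨_, (Nat.sub_add_cancel hm).symm⟩
  have hle : m + 1 ≤ chainLength α β := hm' ▸ chainTopCoeff_le_chainLength α β
  have hw := toEnd_pow_apply_mem hf hv (m + 1)
  have hw0 := prim.pow_toEnd_f_ne_zero_of_eq_nat rfl hle
  have hwβ : (toEnd K L L f ^ (m + 1)) v ∈ rootSpace H β := by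
    have e : ((m + 1) • (-α : H → K) + chainTop α β) = β := by
      rw [coe_chainTop', hm', smul_neg, neg_add_cancel_left]
    rwa [← e]
  obtain ⟨c, hc⟩ := exists_smul_eq_of_mem_rootSpace hα hx hx0 he
  obtain ⟨d, hd⟩ := exists_smul_eq_of_mem_rootSpace hβ hy hy0 hwβ
  intro hxy
  -- Here f^(m+1) v spans the root space of β, and e f^(m+1) v = (m + 1)(ℓ - m) f^m v with ℓ the
  -- chain length, where m + 1 ≤ ℓ. This cannot vanish.
  have h1 := prim.lie_e_pow_succ_toEnd_f m
  rw [← hd, ← hc, smul_lie, lie_smul, hxy, smul_zero, smul_zero, eq_comm, smul_eq_zero] at h1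
  rcases h1 with h1 | h1
  · rcases mul_eq_zero.1 h1 with h2 | h2
    · exact Nat.cast_add_one_ne_zero m h2
    · rw [sub_eq_zero, Nat.cast_inj] at h2
      omega
  · exact prim.pow_toEnd_f_ne_zero_of_eq_nat rfl ((Nat.le_succ m).trans hle) h1

end LieAlgebra.IsKilling

/-! ### The conjugation on roots and root spaces -/

namespace CRAlg

open LieAlgebra

variable {𝔤 : Type*} [LieRing 𝔤] [LieAlgebra ℝ 𝔤]

theorem conj_conj (z : ℂ ⊗[ℝ] 𝔤) : conj 𝔤 (conj 𝔤 z) = z := by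
  obtain ⟨x, y, rfl⟩ := exists_re_im 𝔤 z
  simp only [map_add, conj_tmul, Complex.conj_conj]

theorem conj_lie (z w : ℂ ⊗[ℝ] 𝔤) : conj 𝔤 ⁅z, w⁆ = ⁅conj 𝔤 z, conj 𝔤 w⁆ := by
  obtain ⟨x, y, rfl⟩ := exists_re_im 𝔤 z
  obtain ⟨u, v, rfl⟩ := exists_re_im 𝔤 w
  simp only [map_add, conj_tmul, add_lie, lie_add, LieAlgebra.ExtendScalars.bracket_tmul, map_mul]

theorem exists_tmul_eq_of_conj_eq {z : ℂ ⊗[ℝ] 𝔤} (hz : conj 𝔤 z = z) :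
    ∃ x : 𝔤, z = (1 : ℂ) ⊗ₜ[ℝ] x := by
  obtain ⟨x, y, rfl⟩ := exists_re_im 𝔤 z
  refine ⟨x, ?_⟩
  rw [map_add, conj_tmul, conj_tmul, map_one, Complex.conj_I, TensorProduct.neg_tmul,
    add_right_inj, neg_eq_iff_add_eq_zero, ← two_smul ℂ, smul_eq_zero] at hz
  rw [hz.resolve_left two_ne_zero, add_zero]

variable {𝔥 : LieSubalgebra ℝ 𝔤}

theorem conjDual_apply (α : CartanDual 𝔥) (H : complexify 𝔥) :
    conjDual 𝔥 α H = starRingEnd ℂ (α ⟨conj 𝔤 H, conj_mem_complexify H.2⟩) := rfl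

theorem conjDual_conjDual (α : CartanDual 𝔥) : conjDual 𝔥 (conjDual 𝔥 α) = α := by
  ext H
  simp only [conjDual_apply, conj_conj, Complex.conj_conj]

theorem conjDual_add (α β : CartanDual 𝔥) :
    conjDual 𝔥 (α + β) = conjDual 𝔥 α + conjDual 𝔥 β := by
  ext H
  simp only [conjDual_apply, LinearMap.add_apply, map_add]

theorem conjDual_neg (α : CartanDual 𝔥) : conjDual 𝔥 (-α) = -conjDual 𝔥 α := by
  ext H
  simp only [conjDual_apply, LinearMap.neg_apply, map_neg]

theorem conjDual_zero : conjDual 𝔥 0 = 0 := by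
  ext H
  simp only [conjDual_apply, LinearMap.zero_apply, map_zero]

theorem mem_conjDual_image {S : Set (CartanDual 𝔥)} {β : CartanDual 𝔥} :
    β ∈ conjDual 𝔥 '' S ↔ conjDual 𝔥 β ∈ S :=
  ⟨by rintro ⟨γ, hγ, rfl⟩; rwa [conjDual_conjDual], fun h => ⟨_, h, conjDual_conjDual β⟩⟩

variable [𝔥.IsCartanSubalgebra]

/-- The root space of a functional, as a complex subspace. -/
abbrev rootSub (β : CartanDual 𝔥) : Submodule ℂ (ℂ ⊗[ℝ] 𝔤) :=
  (LieAlgebra.rootSpace (complexify 𝔥) β).toSubmodule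

theorem lie_mem_rootSub {α β : CartanDual 𝔥} {x y : ℂ ⊗[ℝ] 𝔤} (hx : x ∈ rootSub α)
    (hy : y ∈ rootSub β) : ⁅x, y⁆ ∈ rootSub (α + β) :=
  lie_mem_genWeightSpace_of_mem_genWeightSpace hx hy

/-- The sum of the Cartan subalgebra and the root spaces with roots in `S`. -/
def rootPart (S : Set (CartanDual 𝔥)) : Submodule ℂ (ℂ ⊗[ℝ] 𝔤) :=
  (complexify 𝔥).toSubmodule ⊔ ⨆ β ∈ S, rootSub β

theorem rootSub_le_rootPart {S : Set (CartanDual 𝔥)} {β : CartanDual 𝔥} (hβ : β ∈ S) :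
    rootSub β ≤ rootPart S :=
  le_sup_of_le_right (le_iSup₂_of_le β hβ le_rfl)

theorem complexify_le_rootPart (S : Set (CartanDual 𝔥)) :
    (complexify 𝔥).toSubmodule ≤ rootPart S := le_sup_left

theorem rootPart_le {S : Set (CartanDual 𝔥)} {N : Submodule ℂ (ℂ ⊗[ℝ] 𝔤)}
    (hN : (complexify 𝔥).toSubmodule ≤ N) (h : ∀ β ∈ S, rootSub β ≤ N) : rootPart S ≤ N :=
  sup_le hN (iSup₂_le h)

variable [FiniteDimensional ℝ 𝔤]

theorem rootSub_zero : rootSub (0 : CartanDual 𝔥) = (complexify 𝔥).toSubmodule := by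
  have : rootSub (0 : CartanDual 𝔥) =
      (rootSpace (complexify 𝔥) (0 : complexify 𝔥 → ℂ)).toSubmodule := rfl
  rw [this, LieAlgebra.rootSpace_zero_eq]; rfl

variable [LieAlgebra.IsSemisimple ℝ 𝔤]

theorem mem_rootSub {β : CartanDual 𝔥} {x : ℂ ⊗[ℝ] 𝔤} :
    x ∈ rootSub β ↔ ∀ H : complexify 𝔥, ⁅(H : ℂ ⊗[ℝ] 𝔤), x⁆ = β H • x := by
  refine ⟨fun h H => LieAlgebra.IsKilling.lie_eq_smul_of_mem_rootSpace h H, fun h => ?_⟩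
  exact LieModule.weightSpace_le_genWeightSpace _ _
    ((LieModule.mem_weightSpace (M := ℂ ⊗[ℝ] 𝔤) (β : complexify 𝔥 → ℂ) x).2 h)

theorem conj_mem_rootSub {β : CartanDual 𝔥} {x : ℂ ⊗[ℝ] 𝔤} (hx : x ∈ rootSub β) :
    conj 𝔤 x ∈ rootSub (conjDual 𝔥 β) := by
  refine mem_rootSub.2 fun H => ?_
  have h := congrArg (conj 𝔤) (mem_rootSub.1 hx ⟨conj 𝔤 H, conj_mem_complexify H.2⟩)
  rw [conj_lie, conj_conj, LinearMap.map_smulₛₗ] at h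
  exact h

/-- The weight attached to a functional with nonzero root space. -/
def weightOf {β : CartanDual 𝔥} (h : rootSub β ≠ ⊥) :
    LieModule.Weight ℂ (complexify 𝔥) (ℂ ⊗[ℝ] 𝔤) :=
  ⟨β, fun h' => h ((LieSubmodule.toSubmodule_eq_bot _).2 h')⟩

theorem mem_roots_iff {β : CartanDual 𝔥} : β ∈ roots 𝔥 ↔ β ≠ 0 ∧ rootSub β ≠ ⊥ := by
  constructor
  · rintro ⟨i, rfl⟩
    refine ⟨(rootSys 𝔥).ne_zero i, fun h => i.1.2 ?_⟩
    exact (LieSubmodule.toSubmodule_eq_bot _).1 h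
  · rintro ⟨h0, hbot⟩
    have hw : weightOf hbot ∈ (complexify 𝔥).root := by
      rw [Finset.mem_filter]
      exact ⟨Finset.mem_univ _, fun h => h0 (LinearMap.ext fun t => congrFun h t)⟩
    exact ⟨⟨_, hw⟩, LinearMap.ext fun t => rfl⟩

theorem weightOf_isNonZero {β : CartanDual 𝔥} (hβ : β ∈ roots 𝔥) :
    (weightOf (mem_roots_iff.1 hβ).2).IsNonZero :=
  fun h => (mem_roots_iff.1 hβ).1 (LinearMap.ext fun t => congrFun h t)

theorem exists_mem_rootSub {β : CartanDual 𝔥} (hβ : β ∈ roots 𝔥) : ∃ x ∈ rootSub β, x ≠ 0 :=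
  Submodule.exists_mem_ne_zero_of_ne_bot (mem_roots_iff.1 hβ).2

theorem neg_mem_roots {β : CartanDual 𝔥} (hβ : β ∈ roots 𝔥) : -β ∈ roots 𝔥 := by
  obtain ⟨i, rfl⟩ := hβ
  exact ⟨(rootSys 𝔥).reflectionPerm i i, by
    rw [RootPairing.root_reflectionPerm, RootPairing.reflection_apply_self]⟩

theorem conjDual_mem_roots {β : CartanDual 𝔥} (hβ : β ∈ roots 𝔥) :
    conjDual 𝔥 β ∈ roots 𝔥 := by
  obtain ⟨x, hx, hx0⟩ := exists_mem_rootSub hβ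
  refine mem_roots_iff.2 ⟨fun h => (mem_roots_iff.1 hβ).1 ?_, fun h => hx0 ?_⟩
  · rw [← conjDual_conjDual β, h, conjDual_zero]
  · have h1 := conj_mem_rootSub hx
    rw [h, Submodule.mem_bot] at h1
    rw [← conj_conj x, h1, map_zero]

theorem lie_ne_zero_of_mem_rootSub {α β : CartanDual 𝔥} (hα : α ∈ roots 𝔥) (hβ : β ∈ roots 𝔥)
    (hαβ : α + β ∈ roots 𝔥) {x y : ℂ ⊗[ℝ] 𝔤} (hx : x ∈ rootSub α) (hx0 : x ≠ 0)
    (hy : y ∈ rootSub β) (hy0 : y ≠ 0) : ⁅x, y⁆ ≠ 0 := by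
  refine LieAlgebra.IsKilling.lie_ne_zero_of_mem_rootSpace (weightOf_isNonZero hα)
    (weightOf_isNonZero hβ) (fun h => (mem_roots_iff.1 hαβ).2 ?_) hx hx0 hy hy0
  exact (LieSubmodule.toSubmodule_eq_bot _).2 h

theorem exists_smul_eq_of_mem_rootSub {α : CartanDual 𝔥} (hα : α ∈ roots 𝔥) {x y : ℂ ⊗[ℝ] 𝔤}
    (hx : x ∈ rootSub α) (hx0 : x ≠ 0) (hy : y ∈ rootSub α) : ∃ c : ℂ, c • x = y :=
  LieAlgebra.IsKilling.exists_smul_eq_of_mem_rootSpace (weightOf_isNonZero hα) hx hx0 hy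

theorem rootSub_le_of_mem {α : CartanDual 𝔥} (hα : α ∈ roots 𝔥) {x : ℂ ⊗[ℝ] 𝔤}
    {N : Submodule ℂ (ℂ ⊗[ℝ] 𝔤)} (hx : x ∈ rootSub α) (hx0 : x ≠ 0) (hxN : x ∈ N) :
    rootSub α ≤ N := by
  intro y hy
  obtain ⟨c, rfl⟩ := exists_smul_eq_of_mem_rootSub hα hx hx0 hy
  exact N.smul_mem c hxN

theorem rootSub_add_le {α β : CartanDual 𝔥} (hα : α ∈ roots 𝔥) (hβ : β ∈ roots 𝔥)
    (hαβ : α + β ∈ roots 𝔥) {N : Submodule ℂ (ℂ ⊗[ℝ] 𝔤)}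
    (h : ∀ x ∈ rootSub α, ∀ y ∈ rootSub β, ⁅x, y⁆ ∈ N) : rootSub (α + β) ≤ N := by
  obtain ⟨x, hx, hx0⟩ := exists_mem_rootSub hα
  obtain ⟨y, hy, hy0⟩ := exists_mem_rootSub hβ
  exact rootSub_le_of_mem hαβ (lie_mem_rootSub hx hy)
    (lie_ne_zero_of_mem_rootSub hα hβ hαβ hx hx0 hy hy0) (h x hx y hy)

/-! ### Regular subspaces -/

theorem mem_of_rootSub_le_rootPart {S : Set (CartanDual 𝔥)} {γ : CartanDual 𝔥}
    (hγ : γ ∈ roots 𝔥) (h : rootSub γ ≤ rootPart S) : γ ∈ S := by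
  by_contra hγS
  refine (mem_roots_iff.1 hγ).2 ?_
  have hind : iSupIndep fun χ : complexify 𝔥 → ℂ =>
      (rootSpace (complexify 𝔥) χ).toSubmodule :=
    LieSubmodule.iSupIndep_toSubmodule.2
      (LieModule.iSupIndep_genWeightSpace ℂ (complexify 𝔥) (ℂ ⊗[ℝ] 𝔤))
  refine (hind (γ : complexify 𝔥 → ℂ)).eq_bot_of_le (h.trans (sup_le ?_ (iSup₂_le fun β hβ => ?_)))
  · rw [← rootSub_zero]
    refine le_iSup₂_of_le ((0 : CartanDual 𝔥) : complexify 𝔥 → ℂ) (fun h0 => ?_) le_rfl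
    exact (mem_roots_iff.1 hγ).1 (DFunLike.coe_injective h0).symm
  · refine le_iSup₂_of_le (β : complexify 𝔥 → ℂ) (fun h0 => hγS ?_) le_rfl
    rwa [← DFunLike.coe_injective h0]

/-- A subspace containing `𝔥` and invariant under it is regular. -/
theorem eq_rootPart {N : Submodule ℂ (ℂ ⊗[ℝ] 𝔤)} (hN : (complexify 𝔥).toSubmodule ≤ N)
    (hs : ∀ H ∈ complexify 𝔥, ∀ x ∈ N, ⁅H, x⁆ ∈ N) :
    N = rootPart {β ∈ roots 𝔥 | rootSub β ≤ N} := by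
  refine le_antisymm ?_ (sup_le hN (iSup₂_le fun β hβ => hβ.2))
  let N' : LieSubmodule ℂ (complexify 𝔥) (ℂ ⊗[ℝ] 𝔤) :=
    { __ := N, lie_mem := fun {H x} hx => hs H H.2 x hx }
  have h := congrArg LieSubmodule.toSubmodule (LieModule.eq_iSup_inf_genWeightSpace _ _ _ N')
  rw [LieSubmodule.iSup_toSubmodule] at h
  change N = _ at h
  rw [h]
  refine iSup_le fun χ x hx => ?_
  rw [← h]
  have hxN : x ∈ N := hx.1
  have hxχ : x ∈ rootSub (LieModule.Weight.toLinear ℂ (complexify 𝔥) (ℂ ⊗[ℝ] 𝔤) χ) := hx.2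
  by_cases hx0 : x = 0
  · rw [hx0]; exact zero_mem _
  by_cases hz : (LieModule.Weight.toLinear ℂ (complexify 𝔥) (ℂ ⊗[ℝ] 𝔤) χ) = 0
  · rw [hz, rootSub_zero] at hxχ
    exact complexify_le_rootPart _ hxχ
  · have hr : (LieModule.Weight.toLinear ℂ (complexify 𝔥) (ℂ ⊗[ℝ] 𝔤) χ) ∈ roots 𝔥 :=
      mem_roots_iff.2 ⟨hz, fun hb => hx0 (by rwa [hb, Submodule.mem_bot] at hxχ)⟩
    exact rootSub_le_rootPart (S := {β ∈ roots 𝔥 | rootSub β ≤ N})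
      ⟨hr, rootSub_le_of_mem hr hxχ hx0 hxN⟩ hxχ

theorem conj_mem_rootPart {S : Set (CartanDual 𝔥)} {x : ℂ ⊗[ℝ] 𝔤} (hx : x ∈ rootPart S) :
    conj 𝔤 x ∈ rootPart (conjDual 𝔥 '' S) := by
  suffices rootPart S ≤ (rootPart (conjDual 𝔥 '' S)).comap (conj 𝔤) from this hx
  refine rootPart_le (fun y hy => complexify_le_rootPart _ (conj_mem_complexify hy)) ?_
  exact fun β hβ y hy => rootSub_le_rootPart (Set.mem_image_of_mem _ hβ) (conj_mem_rootSub hy)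

end CRAlg

/-! ### Real elements with real root values, and Killing orthogonality -/

namespace CRAlg

open LieAlgebra

variable {𝔤 : Type*} [LieRing 𝔤] [LieAlgebra ℝ 𝔤]

theorem tmul_add_tmul_eq_zero {x y : 𝔤}
    (h : (1 : ℂ) ⊗ₜ[ℝ] x + Complex.I ⊗ₜ[ℝ] y = 0) : x = 0 ∧ y = 0 := by
  have := mem_of_mem_baseChange 𝔤 ⊥ x y (by rw [h]; exact zero_mem _)
  simpa using this

theorem mem_of_tmul_mem_baseChange {p : Submodule ℝ 𝔤} {x : 𝔤}
    (h : (1 : ℂ) ⊗ₜ[ℝ] x ∈ p.baseChange ℂ) : x ∈ p :=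
  (mem_of_mem_baseChange 𝔤 p x 0 (by rwa [TensorProduct.tmul_zero, add_zero])).1

/-- Real and imaginary parts of eigenvectors are eigenvectors, for real eigenvalues. -/
theorem mem_baseChange_eig {H : 𝔤} {r : ℝ} {z : ℂ ⊗[ℝ] 𝔤}
    (hz : ⁅(1 : ℂ) ⊗ₜ[ℝ] H, z⁆ = (r : ℂ) • z) : z ∈ (Triangular.eig H r).baseChange ℂ := by
  obtain ⟨x, y, rfl⟩ := exists_re_im 𝔤 z
  have e : ∀ (c : ℂ) (u : 𝔤), (r : ℂ) • c ⊗ₜ[ℝ] u = c ⊗ₜ[ℝ] (r • u) := by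
    intro c u
    rw [TensorProduct.tmul_smul, TensorProduct.smul_tmul', TensorProduct.smul_tmul',
      smul_eq_mul, Complex.real_smul]
  rw [LieRing.lie_add, smul_add, e, e, LieAlgebra.ExtendScalars.bracket_tmul,
    LieAlgebra.ExtendScalars.bracket_tmul, one_mul, one_mul, ← sub_eq_zero, add_sub_add_comm,
    ← TensorProduct.tmul_sub, ← TensorProduct.tmul_sub] at hz
  obtain ⟨h1, h2⟩ := tmul_add_tmul_eq_zero hz
  exact add_mem
    (Submodule.tmul_mem_baseChange_of_mem _ (Triangular.mem_eig.2 (sub_eq_zero.1 h1)))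
    (Submodule.tmul_mem_baseChange_of_mem _ (Triangular.mem_eig.2 (sub_eq_zero.1 h2)))

theorem killingForm_tmul [FiniteDimensional ℝ 𝔤] (x y : 𝔤) :
    killingForm ℂ (ℂ ⊗[ℝ] 𝔤) ((1 : ℂ) ⊗ₜ[ℝ] x) ((1 : ℂ) ⊗ₜ[ℝ] y) = (killingForm ℝ 𝔤 x y : ℂ) := by
  change LieModule.traceForm ℂ (ℂ ⊗[ℝ] 𝔤) (ℂ ⊗[ℝ] 𝔤) _ _ = _
  rw [LieModule.traceForm_baseChange, LinearMap.BilinForm.baseChange_tmul]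
  simp

variable [FiniteDimensional ℝ 𝔤] {𝔥 : LieSubalgebra ℝ 𝔤} [𝔥.IsCartanSubalgebra]

theorem killingForm_eq_zero_of_mem_rootPart {S : Set (CartanDual 𝔥)} {α : CartanDual 𝔥}
    (h0 : α ≠ 0) (hα : -α ∉ S) {x y : ℂ ⊗[ℝ] 𝔤} (hx : x ∈ rootSub α) (hy : y ∈ rootPart S) :
    killingForm ℂ (ℂ ⊗[ℝ] 𝔤) x y = 0 := by
  have key : ∀ β : CartanDual 𝔥, α + β ≠ 0 →
      rootSub β ≤ LinearMap.ker (killingForm ℂ (ℂ ⊗[ℝ] 𝔤) x) := fun β hβ z hz =>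
    LieAlgebra.killingForm_apply_eq_zero_of_mem_rootSpace_of_add_ne_zero ℂ (ℂ ⊗[ℝ] 𝔤)
      (complexify 𝔥) hx hz fun h => hβ (DFunLike.coe_injective h)
  suffices rootPart S ≤ LinearMap.ker (killingForm ℂ (ℂ ⊗[ℝ] 𝔤) x) from this hy
  refine rootPart_le ?_ fun β hβ => key β fun h => hα ?_
  · rw [← rootSub_zero]
    exact key 0 (by rwa [add_zero])
  · rwa [neg_eq_of_add_eq_zero_right h]

variable [LieAlgebra.IsSemisimple ℝ 𝔤]

theorem rootPart_roots : rootPart (roots 𝔥) = ⊤ := by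
  have h := eq_rootPart (𝔥 := 𝔥) (N := ⊤) le_top fun _ _ _ _ => Submodule.mem_top
  rw [h]
  congr 1
  ext β
  simp

/-- Each root space lies in the complexification of a real eigenspace of ad H, and 𝔥 in that of the
zero eigenspace; so ad H is diagonalizable over ℝ. -/
theorem iSup_eig_eq_top {H : 𝔤} (hH : H ∈ 𝔥)
    (hr : ∀ α ∈ roots 𝔥, ∃ r : ℝ, α ⟨(1 : ℂ) ⊗ₜ[ℝ] H, tmul_mem_complexify 1 hH⟩ = r) :
    ⨆ c, Triangular.eig H c = ⊤ := by
  have key : ∀ (α : CartanDual 𝔥) (r : ℝ),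
      α ⟨(1 : ℂ) ⊗ₜ[ℝ] H, tmul_mem_complexify 1 hH⟩ = r →
      rootSub α ≤ (⨆ c, Triangular.eig H c).baseChange ℂ := by
    intro α r h x hx
    have h1 := mem_rootSub.1 hx ⟨(1 : ℂ) ⊗ₜ[ℝ] H, tmul_mem_complexify 1 hH⟩
    rw [h] at h1
    exact Submodule.baseChange_mono ℂ (le_iSup (Triangular.eig H) r) (mem_baseChange_eig h1)
  have htop : (⊤ : Submodule ℂ (ℂ ⊗[ℝ] 𝔤)) ≤ (⨆ c, Triangular.eig H c).baseChange ℂ := by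
    rw [← rootPart_roots (𝔥 := 𝔥)]
    refine rootPart_le ?_ fun β hβ => (hr β hβ).elim (key β)
    rw [← rootSub_zero]
    exact key 0 0 (by simp)
  exact eq_top_iff.2 fun x _ => mem_of_tmul_mem_baseChange (htop Submodule.mem_top)

/-! ### Parabolic sets -/

section Parabolic

variable {b : (rootSys 𝔥).Base} {φ : Set b.support}

theorem mem_roots_of_mem_Q {β : CartanDual 𝔥} (hβ : β ∈ Q b φ) : β ∈ roots 𝔥 := by
  obtain ⟨i, rfl, -⟩ := hβ
  exact ⟨i, rfl⟩

theorem mem_Q_iff {β : CartanDual 𝔥} : β ∈ Q b φ ↔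
    β ∈ roots 𝔥 ∧ ∃ x : (rootSys 𝔥).rootSpan ℤ, (x : CartanDual 𝔥) = β ∧
      ∀ α ∈ φ, 0 ≤ b.toWeightBasisInt.repr x α := by
  constructor
  · rintro ⟨i, rfl, h⟩
    exact ⟨⟨i, rfl⟩, (rootSys 𝔥).rootSpanMem ℤ i, rfl, h⟩
  · rintro ⟨⟨i, rfl⟩, x, hx, h⟩
    refine ⟨i, rfl, fun α hα => ?_⟩
    have e : (rootSys 𝔥).rootSpanMem ℤ i = x := Subtype.ext hx.symm
    rw [coeff, e]
    exact h α hα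

theorem add_mem_Q {α β : CartanDual 𝔥} (hα : α ∈ Q b φ) (hβ : β ∈ Q b φ)
    (h : α + β ∈ roots 𝔥) : α + β ∈ Q b φ := by
  obtain ⟨-, x, rfl, hx⟩ := mem_Q_iff.1 hα
  obtain ⟨-, y, rfl, hy⟩ := mem_Q_iff.1 hβ
  refine mem_Q_iff.2 ⟨h, x + y, rfl, fun γ hγ => ?_⟩
  rw [map_add]
  exact add_nonneg (hx γ hγ) (hy γ hγ)

theorem mem_Q_or_neg_mem_Q {β : CartanDual 𝔥} (hβ : β ∈ roots 𝔥) :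
    β ∈ Q b φ ∨ -β ∈ Q b φ := by
  have key : ∀ m ∈ AddSubmonoid.closure ((rootSys 𝔥).root '' b.support),
      ∃ x : (rootSys 𝔥).rootSpan ℤ, (x : CartanDual 𝔥) = m ∧
        ∀ α ∈ φ, 0 ≤ b.toWeightBasisInt.repr x α := by
    intro m hm
    induction hm using AddSubmonoid.closure_induction with
    | mem m hm =>
      obtain ⟨i, hi, rfl⟩ := hm
      refine ⟨b.toWeightBasisInt ⟨i, hi⟩, b.coe_toWeightBasisInt_apply _, fun α _ => ?_⟩
      rw [Basis.repr_self]
      exact Finsupp.single_nonneg.2 zero_le_one α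
    | zero => exact ⟨0, rfl, fun α _ => by
      rw [LinearEquiv.map_zero]; exact le_rfl⟩
    | add m n _ _ hm hn =>
      obtain ⟨x, rfl, hx⟩ := hm
      obtain ⟨y, rfl, hy⟩ := hn
      exact ⟨x + y, rfl, fun α hα => by rw [map_add]; exact add_nonneg (hx α hα) (hy α hα)⟩
  have hβ' := neg_mem_roots hβ
  obtain ⟨i, rfl⟩ := hβ
  rcases b.root_mem_or_neg_mem i with h | h
  · exact Or.inl (mem_Q_iff.2 ⟨⟨i, rfl⟩, key _ h⟩)
  · exact Or.inr (mem_Q_iff.2 ⟨hβ', key _ h⟩)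

theorem neg_mem_Q {β : CartanDual 𝔥} (hβ : β ∈ roots 𝔥) (h : β ∉ Q b φ) : -β ∈ Q b φ :=
  (mem_Q_or_neg_mem_Q hβ).resolve_left h

theorem mem_Qneg_iff {β : CartanDual 𝔥} : β ∈ Qneg b φ ↔ β ∈ roots 𝔥 ∧ β ∉ Q b φ := by
  constructor
  · rintro ⟨h1, h2⟩
    rw [neg_neg] at h2
    exact ⟨neg_neg β ▸ neg_mem_roots (mem_roots_of_mem_Q h1), h2⟩
  · rintro ⟨h1, h2⟩
    exact ⟨neg_mem_Q h1 h2, by rwa [neg_neg]⟩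

theorem mem_image_Qneg_iff {β : CartanDual 𝔥} :
    β ∈ conjDual 𝔥 '' Qneg b φ ↔ β ∈ roots 𝔥 ∧ β ∉ conjDual 𝔥 '' Q b φ := by
  rw [mem_conjDual_image, mem_conjDual_image, mem_Qneg_iff]
  exact and_congr_left fun _ => ⟨fun h => conjDual_conjDual β ▸ conjDual_mem_roots h,
    conjDual_mem_roots⟩

theorem mem_image_Q_of_add {α β : CartanDual 𝔥} (hα : α ∈ conjDual 𝔥 '' Q b φ)
    (hβ : β ∈ conjDual 𝔥 '' Q b φ) (h : α + β ∈ roots 𝔥) : α + β ∈ conjDual 𝔥 '' Q b φ := by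
  rw [mem_conjDual_image] at *
  rw [conjDual_add]
  exact add_mem_Q hα hβ (conjDual_add α β ▸ conjDual_mem_roots h)

theorem mem_roots_of_mem_image_Q {β : CartanDual 𝔥} (hβ : β ∈ conjDual 𝔥 '' Q b φ) :
    β ∈ roots 𝔥 := by
  obtain ⟨γ, hγ, rfl⟩ := hβ
  exact conjDual_mem_roots (mem_roots_of_mem_Q hγ)

theorem conjSubmodule_parabolic :
    conjSubmodule (parabolic b φ) = rootPart (conjDual 𝔥 '' Q b φ) := by
  refine le_antisymm ?_ ?_
  · rintro _ ⟨x, hx, rfl⟩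
    exact conj_mem_rootPart hx
  · intro x hx
    refine ⟨conj 𝔤 x, ?_, conj_conj x⟩
    have h := conj_mem_rootPart hx
    rw [← Set.image_comp] at h
    have e : conjDual 𝔥 ∘ conjDual 𝔥 = id := funext conjDual_conjDual
    rwa [e, Set.image_id] at h

theorem tmul_mem_rootPart_image {x : 𝔤} (hx : x ∈ isotropy (parabolic b φ)) :
    (1 : ℂ) ⊗ₜ[ℝ] x ∈ rootPart (conjDual 𝔥 '' Q b φ) := by
  have h := conj_mem_rootPart (S := Q b φ) (x := (1 : ℂ) ⊗ₜ[ℝ] x) hx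
  rwa [conj_tmul, map_one] at h

/-- The vector X = E + σ(E), with E in the root space of -β, contradicts
`Triangular.mem_of_killingForm_eq_zero`. -/
theorem false_of_pos_apply (hmin : IsMinimal (parabolic b φ)) {β : CartanDual 𝔥}
    (hβ : β ∈ Qn b φ) (hσβ : conjDual 𝔥 β ∉ Q b φ) {H : 𝔤} (hH : H ∈ 𝔥)
    (hr : ∀ α ∈ roots 𝔥, ∃ r : ℝ, α ⟨(1 : ℂ) ⊗ₜ[ℝ] H, tmul_mem_complexify 1 hH⟩ = r) {n : ℝ}
    (hn : β ⟨(1 : ℂ) ⊗ₜ[ℝ] H, tmul_mem_complexify 1 hH⟩ = n) (hn0 : 0 < n) : False := by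
  obtain ⟨𝔱, ht, hti⟩ := hmin
  have hβr := mem_roots_of_mem_Q hβ.1
  have hσr := conjDual_mem_roots hβr
  obtain ⟨E, hE, hE0⟩ := exists_mem_rootSub (neg_mem_roots hβr)
  have hσE := conj_mem_rootSub hE
  rw [conjDual_neg] at hσE
  obtain ⟨X, hX⟩ := exists_tmul_eq_of_conj_eq (z := E + conj 𝔤 E)
    (by rw [map_add, conj_conj, add_comm])
  have hXeig : X ∈ Triangular.eig H (-n) := by
    refine mem_of_tmul_mem_baseChange (mem_baseChange_eig ?_)
    have h1 := mem_rootSub.1 hE ⟨(1 : ℂ) ⊗ₜ[ℝ] H, tmul_mem_complexify 1 hH⟩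
    have h2 := mem_rootSub.1 hσE ⟨(1 : ℂ) ⊗ₜ[ℝ] H, tmul_mem_complexify 1 hH⟩
    simp only [LinearMap.neg_apply, conjDual_apply, conj_tmul, map_one, hn, Complex.conj_ofReal]
      at h1 h2
    rw [← hX, LieRing.lie_add, h1, h2, smul_add, Complex.ofReal_neg]
  have hXmem : X ∈ isotropy (parabolic b φ) := by
    refine Triangular.mem_of_killingForm_eq_zero ht
      (I := (isotropy (parabolic b φ)).toSubmodule) hti (iSup_eig_eq_top hH hr) ?_
      (neg_lt_zero.2 hn0) hXeig ?_
    · exact fun x hx => (isotropy (parabolic b φ)).lie_mem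
        (complexify_le_rootPart (Q b φ) (tmul_mem_complexify 1 hH)) hx
    -- A real y in 𝔮 also lies in σ(𝔮). It has no component along β, since β is not in σ(Q), so E is
    -- orthogonal to it; it has none along σ(β), so σ(E) is too.
    · intro y hy
      have h1 := killingForm_eq_zero_of_mem_rootPart (neg_ne_zero.2 (mem_roots_iff.1 hβr).1)
        (S := conjDual 𝔥 '' Q b φ) (by rwa [neg_neg, mem_conjDual_image]) hE
        (tmul_mem_rootPart_image hy)
      have h2 := killingForm_eq_zero_of_mem_rootPart (neg_ne_zero.2 (mem_roots_iff.1 hσr).1)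
        (S := Q b φ) (by rwa [neg_neg]) hσE hy
      have h3 := killingForm_tmul X y
      rw [← hX, map_add, LinearMap.add_apply, h1, h2, add_zero] at h3
      exact_mod_cast h3.symm
  -- σ(E) lies in 𝔮 because σ(β) is not in Q. So X in 𝔮 would put E in 𝔮 and -β in Q.
  have hE' : E ∈ rootPart (Q b φ) := by
    have h1 : (1 : ℂ) ⊗ₜ[ℝ] X ∈ rootPart (Q b φ) := hXmem
    rw [← hX] at h1
    exact (Submodule.add_mem_iff_left _ (rootSub_le_rootPart (neg_mem_Q hσr hσβ) hσE)).1 h1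
  exact hβ.2 (mem_of_rootSub_le_rootPart (neg_mem_roots hβr)
    (rootSub_le_of_mem (neg_mem_roots hβr) hE hE0 hE'))

theorem exists_int_eq_apply_coroot {α : CartanDual 𝔥} (hα : α ∈ roots 𝔥)
    (i : (complexify 𝔥).root) : ∃ m : ℤ, α ((rootSys 𝔥).coroot i) = m := by
  obtain ⟨j, rfl⟩ := hα
  exact ⟨_, LieAlgebra.IsKilling.apply_coroot_eq_cast i.1 j.1⟩

/-- For a minimal CR algebra, the roots of the nilradical that `σ` moves out of the parabolic set
are imaginary. -/
theorem conjDual_eq_neg (hmin : IsMinimal (parabolic b φ)) {β : CartanDual 𝔥}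
    (hβ : β ∈ Qn b φ) (hσβ : conjDual 𝔥 β ∉ Q b φ) : conjDual 𝔥 β = -β := by
  have hβr := mem_roots_of_mem_Q hβ.1
  have hσr := conjDual_mem_roots hβr
  suffices h : ∀ i, β ((rootSys 𝔥).coroot i) + conjDual 𝔥 β ((rootSys 𝔥).coroot i) = 0 by
    refine LinearMap.ext_on (RootPairing.IsRootSystem.span_coroot_eq_top (P := rootSys 𝔥)) ?_
    rintro _ ⟨i, rfl⟩
    exact eq_neg_of_add_eq_zero_right (h i)
  intro i
  set T : complexify 𝔥 := (rootSys 𝔥).coroot i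
  set T' : complexify 𝔥 := ⟨conj 𝔤 T, conj_mem_complexify T.2⟩
  -- Roots are integral on H = T + σ(T), because α(σ(T)) is the conjugate of the integer σ(α)(T). In
  -- particular β(H) = β(T) + σ(β)(T), the number to be shown zero.
  obtain ⟨H, hH⟩ := exists_tmul_eq_of_conj_eq (z := (T : ℂ ⊗[ℝ] 𝔤) + conj 𝔤 T)
    (by rw [map_add, conj_conj, add_comm])
  have hH𝔥 : H ∈ 𝔥 := by
    refine mem_of_tmul_mem_baseChange (p := 𝔥.toSubmodule) ?_
    rw [← hH]
    exact add_mem T.2 T'.2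
  have hT : (⟨(1 : ℂ) ⊗ₜ[ℝ] H, tmul_mem_complexify 1 hH𝔥⟩ : complexify 𝔥) = T + T' :=
    Subtype.ext hH.symm
  have hval : ∀ α ∈ roots 𝔥, ∃ m : ℤ, α (T + T') = m ∧ α T + conjDual 𝔥 α T = m := by
    intro α hα
    obtain ⟨k, hk⟩ := exists_int_eq_apply_coroot hα i
    obtain ⟨l, hl⟩ := exists_int_eq_apply_coroot (conjDual_mem_roots hα) i
    refine ⟨k + l, ?_, ?_⟩
    · have h1 : α T' = l := by
        rw [← Complex.conj_conj (α T'), ← conjDual_apply, hl, map_intCast]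
      rw [map_add, h1, hk, Int.cast_add]
    · rw [hk, hl, Int.cast_add]
  have hr : ∀ α ∈ roots 𝔥,
      ∃ r : ℝ, α ⟨(1 : ℂ) ⊗ₜ[ℝ] H, tmul_mem_complexify 1 hH𝔥⟩ = r := by
    intro α hα
    obtain ⟨m, hm, -⟩ := hval α hα
    exact ⟨m, by rw [hT, hm, Complex.ofReal_intCast]⟩
  obtain ⟨m, hm, hm'⟩ := hval β hβr
  rw [hm']
  rcases lt_trichotomy m 0 with h | h | h
  -- The root -σ(β) satisfies the same hypotheses as β, and its value at H is -m > 0.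
  · exfalso
    obtain ⟨m', hm1, hm2⟩ := hval _ hσr
    rw [conjDual_conjDual, add_comm, hm'] at hm2
    refine false_of_pos_apply hmin (β := -conjDual 𝔥 β) (n := (-m : ℤ))
      ⟨neg_mem_Q hσr hσβ, by rwa [neg_neg]⟩ ?_ hH𝔥 hr ?_ ?_
    · rw [conjDual_neg, conjDual_conjDual]
      exact hβ.2
    · rw [hT, LinearMap.neg_apply, hm1, ← hm2]
      push_cast
      rfl
    · exact_mod_cast neg_pos.2 h
  · rw [h, Int.cast_zero]
  · exfalso
    refine false_of_pos_apply hmin hβ hσβ (n := m) hH𝔥 hr ?_ (by exact_mod_cast h)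
    rw [hT, hm, Complex.ofReal_intCast]

theorem Q_inter_image_Qneg (hmin : IsMinimal (parabolic b φ)) :
    Q b φ ∩ conjDual 𝔥 '' Qneg b φ =
      (Qn b φ ∩ imaginaryRoots 𝔥) ∪ (Qr b φ ∩ conjDual 𝔥 '' Qneg b φ) := by
  ext β
  constructor
  · rintro ⟨h1, h2⟩
    by_cases hn : -β ∈ Q b φ
    · exact Or.inr ⟨⟨h1, hn⟩, h2⟩
    · have h3 := (mem_image_Qneg_iff.1 h2).2
      rw [mem_conjDual_image] at h3
      exact Or.inl ⟨⟨h1, hn⟩, mem_roots_of_mem_Q h1, conjDual_eq_neg hmin ⟨h1, hn⟩ h3⟩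
  · rintro (⟨h1, h2, h3⟩ | ⟨h1, h2⟩)
    · refine ⟨h1.1, mem_image_Qneg_iff.2 ⟨h2, ?_⟩⟩
      rw [mem_conjDual_image, h3]
      exact h1.2
    · exact ⟨h1.1, h2⟩

end Parabolic

end CRAlg

/-! ### The chain `freeman` and the Levi order -/

namespace CRAlg

section Freeman

variable {𝔤 : Type*} [LieRing 𝔤] [LieAlgebra ℝ 𝔤] {𝔮 : LieSubalgebra ℂ (ℂ ⊗[ℝ] 𝔤)}

theorem lie_mem_conjSubmodule {x y : ℂ ⊗[ℝ] 𝔤} (hx : x ∈ conjSubmodule 𝔮)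
    (hy : y ∈ conjSubmodule 𝔮) : ⁅x, y⁆ ∈ conjSubmodule 𝔮 := by
  obtain ⟨u, hu, rfl⟩ := hx
  obtain ⟨v, hv, rfl⟩ := hy
  exact ⟨⁅u, v⁆, 𝔮.lie_mem hu hv, conj_lie u v⟩

theorem freeman_antitone : Antitone (freeman 𝔮) :=
  antitone_nat_of_succ_le fun _ _ hx => hx.1

theorem inf_le_freeman (k : ℕ) : 𝔮.toSubmodule ⊓ conjSubmodule 𝔮 ≤ freeman 𝔮 k := by
  induction k with
  | zero => exact inf_le_left
  | succ k ih =>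
    exact fun x hx => ⟨ih hx, fun W hW =>
      Submodule.mem_sup_right (lie_mem_conjSubmodule hx.2 hW)⟩

/-- By the Jacobi identity, since ad x preserves both 𝔮⁽ᵏ⁾ and σ(𝔮). Applied to 𝔥 it makes every
𝔮⁽ᵏ⁾ a sum of 𝔥 and root spaces. -/
theorem lie_mem_freeman {x z : ℂ ⊗[ℝ] 𝔤} (hx : x ∈ 𝔮.toSubmodule ⊓ conjSubmodule 𝔮) {k : ℕ}
    (hz : z ∈ freeman 𝔮 k) : ⁅x, z⁆ ∈ freeman 𝔮 k := by
  induction k generalizing z with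
  | zero => exact 𝔮.lie_mem hx.1 hz
  | succ k ih =>
    refine ⟨ih hz.1, fun W hW => ?_⟩
    have hN : ∀ w ∈ freeman 𝔮 k ⊔ conjSubmodule 𝔮, ⁅x, w⁆ ∈ freeman 𝔮 k ⊔ conjSubmodule 𝔮 := by
      intro w hw
      obtain ⟨u, hu, v, hv, rfl⟩ := Submodule.mem_sup.1 hw
      rw [LieRing.lie_add]
      exact Submodule.add_mem_sup (ih hu) (lie_mem_conjSubmodule hx.2 hv)
    have e : ⁅⁅x, z⁆, W⁆ = ⁅x, ⁅z, W⁆⁆ - ⁅z, ⁅x, W⁆⁆ := lie_lie x z W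
    rw [e]
    exact sub_mem (hN _ (hz.2 W hW)) (hz.2 _ (lie_mem_conjSubmodule hx.2 hW))

/-- If l < k, then 𝔮⁽ᵏ⁻¹⁾ is contained in 𝔮⁽ˡ⁾ = 𝔮 ∩ σ(𝔮), hence in 𝔮⁽ᵏ⁾, against strictness. -/
theorem IsNondegenerateOfOrder.le {k l : ℕ} (hk : IsNondegenerateOfOrder 𝔮 k)
    (hl : IsNondegenerateOfOrder 𝔮 l) : k ≤ l := by
  by_contra! h
  have h1 := freeman_antitone (𝔮 := 𝔮) (Nat.le_sub_one_of_lt h)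
  rw [hl.2.2] at h1
  exact (hk.2.1.trans_le h1).not_ge (inf_le_freeman k)

theorem leviOrder_eq {k : ℕ} (hk : IsNondegenerateOfOrder 𝔮 k) : leviOrder 𝔮 = k :=
  le_antisymm (iInf₂_le k hk) (le_iInf₂ fun _ hl => Nat.cast_le.2 (IsNondegenerateOfOrder.le hk hl))

end Freeman

/-! ### The chain `freeman` in terms of roots -/

variable {𝔤 : Type*} [LieRing 𝔤] [LieAlgebra ℝ 𝔤] [FiniteDimensional ℝ 𝔤]
  [LieAlgebra.IsSemisimple ℝ 𝔤] {𝔥 : LieSubalgebra ℝ 𝔤} [𝔥.IsCartanSubalgebra]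
  {b : (rootSys 𝔥).Base} {φ : Set b.support}

theorem rootSub_le_parabolic_iff {β : CartanDual 𝔥} (hβ : β ∈ roots 𝔥) :
    rootSub β ≤ (parabolic b φ).toSubmodule ↔ β ∈ Q b φ :=
  ⟨mem_of_rootSub_le_rootPart hβ, rootSub_le_rootPart⟩

theorem rootSub_le_conjSubmodule_iff {β : CartanDual 𝔥} (hβ : β ∈ roots 𝔥) :
    rootSub β ≤ conjSubmodule (parabolic b φ) ↔ β ∈ conjDual 𝔥 '' Q b φ := by
  rw [conjSubmodule_parabolic]
  exact ⟨mem_of_rootSub_le_rootPart hβ, rootSub_le_rootPart⟩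

theorem complexify_le_inf : (complexify 𝔥).toSubmodule ≤
    (parabolic b φ).toSubmodule ⊓ conjSubmodule (parabolic b φ) := by
  rw [conjSubmodule_parabolic]
  exact le_inf (complexify_le_rootPart _) (complexify_le_rootPart _)

theorem complexify_le_freeman (k : ℕ) :
    (complexify 𝔥).toSubmodule ≤ freeman (parabolic b φ) k :=
  complexify_le_inf.trans (inf_le_freeman k)

theorem freeman_eq_rootPart (k : ℕ) : freeman (parabolic b φ) k =
    rootPart {β ∈ roots 𝔥 | rootSub β ≤ freeman (parabolic b φ) k} :=
  eq_rootPart (complexify_le_freeman k) fun _ hH _ hx => lie_mem_freeman (complexify_le_inf hH) hx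

theorem rootSub_le_sup_iff {β : CartanDual 𝔥} (hβ : β ∈ roots 𝔥) (k : ℕ) :
    rootSub β ≤ freeman (parabolic b φ) k ⊔ conjSubmodule (parabolic b φ) ↔
      rootSub β ≤ freeman (parabolic b φ) k ∨ β ∈ conjDual 𝔥 '' Q b φ := by
  constructor
  · intro h
    have hle : freeman (parabolic b φ) k ⊔ conjSubmodule (parabolic b φ) ≤
        rootPart ({β ∈ roots 𝔥 | rootSub β ≤ freeman (parabolic b φ) k} ∪
          conjDual 𝔥 '' Q b φ) := by
      rw [conjSubmodule_parabolic]
      refine sup_le ((freeman_eq_rootPart k).le.trans ?_) ?_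
      · exact rootPart_le (complexify_le_rootPart _) fun γ hγ => rootSub_le_rootPart (Or.inl hγ)
      · exact rootPart_le (complexify_le_rootPart _) fun γ hγ => rootSub_le_rootPart (Or.inr hγ)
    exact (mem_of_rootSub_le_rootPart hβ (h.trans hle)).imp_left And.right
  · rintro (h | h)
    · exact h.trans le_sup_left
    · exact ((rootSub_le_conjSubmodule_iff hβ).2 h).trans le_sup_right

/-- The forward direction rests on the bracket of the two root spaces filling the whole root space
of β + α. -/
theorem rootSub_le_freeman_succ_iff {β : CartanDual 𝔥} (hβ : β ∈ roots 𝔥) (k : ℕ) :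
    rootSub β ≤ freeman (parabolic b φ) (k + 1) ↔ rootSub β ≤ freeman (parabolic b φ) k ∧
      ∀ α ∈ conjDual 𝔥 '' Q b φ, β + α ∈ roots 𝔥 →
        rootSub (β + α) ≤ freeman (parabolic b φ) k ∨ β + α ∈ conjDual 𝔥 '' Q b φ := by
  constructor
  · refine fun h => ⟨h.trans (freeman_antitone k.le_succ), fun α hα hβα => ?_⟩
    have hαr := mem_roots_of_mem_image_Q hα
    refine (rootSub_le_sup_iff hβα k).1 (rootSub_add_le hβ hαr hβα fun x hx y hy => ?_)
    exact (h hx).2 y ((rootSub_le_conjSubmodule_iff hαr).2 hα hy)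
  · refine fun h x hx => ⟨h.1 hx, fun W hW => ?_⟩
    rw [conjSubmodule_parabolic] at hW
    let f : (ℂ ⊗[ℝ] 𝔤) →ₗ[ℂ] (ℂ ⊗[ℝ] 𝔤) := LieAlgebra.ad ℂ (ℂ ⊗[ℝ] 𝔤) x
    suffices rootPart (conjDual 𝔥 '' Q b φ) ≤
      (freeman (parabolic b φ) k ⊔ conjSubmodule (parabolic b φ)).comap f from this hW
    refine rootPart_le ?_ fun α hα => ?_
    · intro H hH
      refine Submodule.mem_sup_left (h.1 ?_)
      rw [← rootSub_zero] at hH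
      have h2 := lie_mem_rootSub hx hH
      rwa [add_zero] at h2
    · intro y hy
      have hxy : ⁅x, y⁆ ∈ rootSub (β + α) := lie_mem_rootSub hx hy
      change ⁅x, y⁆ ∈ freeman (parabolic b φ) k ⊔ conjSubmodule (parabolic b φ)
      by_cases h0 : β + α = 0
      · rw [h0, rootSub_zero] at hxy
        exact Submodule.mem_sup_left (complexify_le_freeman k hxy)
      by_cases hbot : rootSub (β + α) = ⊥
      · rw [hbot, Submodule.mem_bot] at hxy
        rw [hxy]
        exact zero_mem _
      have hr := mem_roots_iff.2 ⟨h0, hbot⟩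
      exact (rootSub_le_sup_iff hr k).2 (h.2 α hα hr) hxy

theorem freeman_eq_inf_iff {k : ℕ} : freeman (parabolic b φ) k =
    (parabolic b φ).toSubmodule ⊓ conjSubmodule (parabolic b φ) ↔
      ∀ β ∈ roots 𝔥, rootSub β ≤ freeman (parabolic b φ) k → β ∈ conjDual 𝔥 '' Q b φ := by
  constructor
  · intro h β hβ hle
    rw [h] at hle
    exact (rootSub_le_conjSubmodule_iff hβ).1 (hle.trans inf_le_right)
  · refine fun h => le_antisymm (le_inf (freeman_antitone k.zero_le) ?_) (inf_le_freeman k)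
    rw [freeman_eq_rootPart]
    exact rootPart_le (complexify_le_inf.trans inf_le_right) fun β hβ =>
      (rootSub_le_conjSubmodule_iff hβ.1).2 (h β hβ.1 hβ.2)

theorem mem_Q_of_rootSub_le_freeman {β : CartanDual 𝔥} (hβ : β ∈ roots 𝔥) {k : ℕ}
    (h : rootSub β ≤ freeman (parabolic b φ) k) : β ∈ Q b φ :=
  (rootSub_le_parabolic_iff hβ).1 (h.trans (freeman_antitone k.zero_le))

/-! ### Escaping chains of roots -/

/-- Length 0, excluded in `kIndex`, is the base case for the induction on chains. -/
theorem hasEscape_zero {β : CartanDual 𝔥} : HasEscape b φ β 0 ↔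
    β ∈ roots 𝔥 ∧ β ∉ Q b φ ∧ β ∉ conjDual 𝔥 '' Q b φ := by
  have h : HasEscape b φ β 0 ↔ β ∈ Qneg b φ ∩ conjDual 𝔥 '' Qneg b φ := by
    constructor
    · rintro ⟨α, -, -, h⟩
      simpa using h
    · intro h
      exact ⟨0, fun i hi => absurd hi (Nat.not_lt_zero i), fun h h1 h2 => by omega, by simpa using h⟩
  rw [h, Set.mem_inter_iff, mem_Qneg_iff, mem_image_Qneg_iff]
  tauto

theorem hasEscape_succ {β : CartanDual 𝔥} {k : ℕ} : HasEscape b φ β (k + 1) ↔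
    ∃ α ∈ conjDual 𝔥 '' Q b φ, β + α ∈ roots 𝔥 ∧ HasEscape b φ (β + α) k := by
  have e : ∀ (α : ℕ → CartanDual 𝔥) (h : ℕ), β + ∑ i ∈ Finset.range (h + 1), α i =
      β + α 0 + ∑ i ∈ Finset.range h, α (i + 1) := by
    intro α h
    rw [Finset.sum_range_succ', add_comm (∑ i ∈ Finset.range h, α (i + 1)), add_assoc]
  constructor
  · rintro ⟨α, hα, hr, hend⟩
    refine ⟨α 0, hα 0 k.succ_pos, ?_, fun i => α (i + 1),
      fun i hi => hα _ (Nat.succ_lt_succ hi), fun h h1 h2 => ?_, ?_⟩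
    · simpa using hr 1 le_rfl (Nat.le_add_left 1 k)
    · rw [← e]
      exact hr _ (Nat.le_add_left 1 h) (Nat.succ_le_succ h2)
    · rwa [← e]
  · rintro ⟨α₀, hα₀, hr₀, α, hα, hr, hend⟩
    refine ⟨fun i => Nat.casesOn i α₀ α, ?_, ?_, ?_⟩
    · rintro (_ | i) hi
      · exact hα₀
      · exact hα i (Nat.lt_of_succ_lt_succ hi)
    · rintro (_ | h) h1 h2
      · exact absurd h1 (by omega)
      · rw [e]
        rcases Nat.eq_zero_or_pos h with rfl | h3
        · simpa using hr₀
        · exact hr h h3 (Nat.le_of_succ_le_succ h2)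
    · rwa [e]

/-- σ(Q) is closed under those sums that are roots, so a chain starting in it never leaves it. -/
theorem not_hasEscape_of_mem {β : CartanDual 𝔥} (hβ : β ∈ conjDual 𝔥 '' Q b φ) (k : ℕ) :
    ¬ HasEscape b φ β k := by
  induction k generalizing β with
  | zero => exact fun h => (hasEscape_zero.1 h).2.2 hβ
  | succ k ih =>
    intro h
    obtain ⟨α, hα, hr, h⟩ := hasEscape_succ.1 h
    exact ih (mem_image_Q_of_add hβ hα hr) h

/-- The Freeman sequence in terms of escaping chains of roots. -/
theorem not_rootSub_le_freeman_iff {β : CartanDual 𝔥} (hβ : β ∈ roots 𝔥)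
    (hσ : β ∉ conjDual 𝔥 '' Q b φ) {k : ℕ} :
    ¬ rootSub β ≤ freeman (parabolic b φ) k ↔ ∃ j ≤ k, HasEscape b φ β j := by
  induction k generalizing β with
  | zero =>
    have h0 : rootSub β ≤ freeman (parabolic b φ) 0 ↔ β ∈ Q b φ := rootSub_le_parabolic_iff hβ
    rw [h0]
    constructor
    · exact fun h => ⟨0, le_rfl, hasEscape_zero.2 ⟨hβ, h, hσ⟩⟩
    · rintro ⟨j, hj, hesc⟩
      rw [Nat.le_zero.1 hj] at hesc
      exact (hasEscape_zero.1 hesc).2.1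
  | succ k ih =>
    rw [rootSub_le_freeman_succ_iff hβ]
    constructor
    · intro h
      by_cases hk : rootSub β ≤ freeman (parabolic b φ) k
      · have h' : ∃ α ∈ conjDual 𝔥 '' Q b φ, β + α ∈ roots 𝔥 ∧
            ¬ rootSub (β + α) ≤ freeman (parabolic b φ) k ∧ β + α ∉ conjDual 𝔥 '' Q b φ := by
          by_contra! hc
          exact h ⟨hk, fun α hα hr => or_iff_not_imp_left.2 (hc α hα hr)⟩
        obtain ⟨α, hα, hr, h1, h2⟩ := h'
        obtain ⟨j, hj, hesc⟩ := (ih hr h2).1 h1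
        exact ⟨j + 1, Nat.succ_le_succ hj, hasEscape_succ.2 ⟨α, hα, hr, hesc⟩⟩
      · obtain ⟨j, hj, hesc⟩ := (ih hβ hσ).1 hk
        exact ⟨j, hj.trans k.le_succ, hesc⟩
    · rintro ⟨j, hj, hesc⟩ ⟨hk, hα⟩
      rcases hj.lt_or_eq with hj | rfl
      · exact (ih hβ hσ).2 ⟨j, Nat.le_of_lt_succ hj, hesc⟩ hk
      · obtain ⟨α, hα', hr, hesc⟩ := hasEscape_succ.1 hesc
        -- The next root of an escaping chain avoids σ(Q) as well, so the induction hypothesis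
        -- applies to it.
        have hn : β + α ∉ conjDual 𝔥 '' Q b φ := fun h => not_hasEscape_of_mem h k hesc
        exact (ih hr hn).2 ⟨k, le_rfl, hesc⟩ ((hα α hα' hr).resolve_right hn)

/-- On the reductive part the Freeman sequence is constant from the first step on. -/
theorem rootSub_le_freeman_of_mem_Qr {β : CartanDual 𝔥} (hβ : β ∈ Qr b φ)
    (h : rootSub β ≤ freeman (parabolic b φ) 1) (k : ℕ) :
    rootSub β ≤ freeman (parabolic b φ) k := by
  have hβr := mem_roots_of_mem_Q hβ.1
  induction k with
  | zero => exact h.trans (freeman_antitone zero_le_one)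
  | succ k ih =>
    refine (rootSub_le_freeman_succ_iff hβr k).2 ⟨ih, fun α hα hr => ?_⟩
    have hαr := mem_roots_of_mem_image_Q hα
    -- If α is in Q, its root space lies in 𝔮 ∩ σ(𝔮), which preserves 𝔮⁽ᵏ⁾. If not, β + α cannot be
    -- in Q, as adding -β from Q would return α; survival in 𝔮⁽¹⁾ then forces β + α into σ(Q).
    by_cases hαQ : α ∈ Q b φ
    · rw [add_comm] at hr ⊢
      refine Or.inl (rootSub_add_le hαr hβr hr fun x hx y hy => lie_mem_freeman ⟨?_, ?_⟩ (ih hy))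
      · exact (rootSub_le_parabolic_iff hαr).2 hαQ hx
      · exact (rootSub_le_conjSubmodule_iff hαr).2 hα hx
    · refine Or.inr ((((rootSub_le_freeman_succ_iff hβr 0).1 h).2 α hα hr).resolve_left fun h0 => ?_)
      have e : β + α + -β = α := by abel
      exact hαQ (e ▸ add_mem_Q (mem_Q_of_rootSub_le_freeman hr h0) hβ.2 (e.symm ▸ hαr))

/-- Strictness at step k leaves a root of 𝔮⁽ᵏ⁻¹⁾ outside σ(Q). As k - 1 ≥ 1, a root of Q^r would
persist into 𝔮⁽ᵏ⁾ = 𝔮 ∩ σ(𝔮), so the first part of the theorem makes it an imaginary root of Q^n. -/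
theorem exists_mem_Qn_of_two_le (hmin : IsMinimal (parabolic b φ)) {k : ℕ}
    (hk : IsNondegenerateOfOrder (parabolic b φ) k) (h2 : 2 ≤ k) :
    ∃ β ∈ Qn b φ ∩ imaginaryRoots 𝔥, rootSub β ≤ freeman (parabolic b φ) (k - 1) := by
  have h : ¬ ∀ β ∈ roots 𝔥, rootSub β ≤ freeman (parabolic b φ) (k - 1) →
      β ∈ conjDual 𝔥 '' Q b φ := by
    rw [← freeman_eq_inf_iff, ← hk.2.2]
    exact hk.2.1.ne'
  push Not at h
  obtain ⟨β, hβ, hle, hσ⟩ := h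
  have hβQ := mem_Q_of_rootSub_le_freeman hβ hle
  have hmem : β ∈ Q b φ ∩ conjDual 𝔥 '' Qneg b φ := ⟨hβQ, mem_image_Qneg_iff.2 ⟨hβ, hσ⟩⟩
  rw [Q_inter_image_Qneg hmin] at hmem
  refine ⟨β, hmem.resolve_right fun hr => hσ ?_, hle⟩
  refine freeman_eq_inf_iff.1 hk.2.2 β hβ (rootSub_le_freeman_of_mem_Qr hr.1 ?_ k)
  exact hle.trans (freeman_antitone (by omega))

theorem one_le_kIndex (β : CartanDual 𝔥) : 1 ≤ kIndex b φ β :=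
  le_iInf₂ fun _ h => by exact_mod_cast h.1

theorem leviOrder_eq_one (hmin : IsMinimal (parabolic b φ))
    (hfin : IsFinitelyNondegenerate (parabolic b φ)) (h : Qn b φ ∩ imaginaryRoots 𝔥 = ∅) :
    leviOrder (parabolic b φ) = 1 := by
  obtain ⟨k, hk⟩ := hfin
  rw [leviOrder_eq hk]
  have h1 : k = 1 := by
    refine le_antisymm ?_ hk.1
    by_contra! h2
    obtain ⟨β, hβ, -⟩ := exists_mem_Qn_of_two_le hmin hk h2
    rw [h] at hβ
    exact hβ
  rw [h1, Nat.cast_one]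

theorem leviOrder_eq_iSup (hmin : IsMinimal (parabolic b φ))
    (hfin : IsFinitelyNondegenerate (parabolic b φ)) (h : Qn b φ ∩ imaginaryRoots 𝔥 ≠ ∅) :
    leviOrder (parabolic b φ) = ⨆ β ∈ Qn b φ ∩ imaginaryRoots 𝔥, kIndex b φ β := by
  obtain ⟨k, hk⟩ := hfin
  rw [leviOrder_eq hk]
  have hσ : ∀ β ∈ Qn b φ ∩ imaginaryRoots 𝔥, β ∉ conjDual 𝔥 '' Q b φ := by
    intro β hβ
    rw [mem_conjDual_image, hβ.2.2]
    exact hβ.1.2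
  refine le_antisymm ?_ (iSup₂_le fun β hβ => ?_)
  · rcases hk.1.eq_or_lt with rfl | h2
    · obtain ⟨β, hβ⟩ := Set.nonempty_iff_ne_empty.2 h
      exact le_iSup₂_of_le β hβ (by exact_mod_cast one_le_kIndex β)
    · obtain ⟨β, hβ, hle⟩ := exists_mem_Qn_of_two_le hmin hk h2
      -- This β is still in 𝔮⁽ᵏ⁻¹⁾, so it has no escape of length below k.
      refine le_iSup₂_of_le β hβ (le_iInf₂ fun j hj => Nat.cast_le.2 ?_)
      by_contra! hjk
      exact (not_rootSub_le_freeman_iff hβ.2.1 (hσ β hβ)).2 ⟨j, by omega, hj.2⟩ hle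
  -- Conversely 𝔮⁽ᵏ⁾ = 𝔮 ∩ σ(𝔮) contains no root outside σ(Q), so β escapes within k steps, and in
  -- at least one because β is in Q.
  · obtain ⟨j, hj, hesc⟩ := (not_rootSub_le_freeman_iff hβ.2.1 (hσ β hβ)).1
      fun hle => hσ β hβ (freeman_eq_inf_iff.1 hk.2.2 β hβ.2.1 hle)
    have hj1 : 1 ≤ j := by
      rcases Nat.eq_zero_or_pos j with rfl | h0
      · exact absurd hβ.1.1 (hasEscape_zero.1 hesc).2.1
      · exact h0
    exact (iInf₂_le j ⟨hj1, hesc⟩).trans (Nat.cast_le.2 hj)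

end CRAlg

end

theorem mainTheorem4 {𝔤 : Type*} [LieRing 𝔤] [LieAlgebra ℝ 𝔤] [FiniteDimensional ℝ 𝔤]
    [LieAlgebra.IsSemisimple ℝ 𝔤] (𝔥 : LieSubalgebra ℝ 𝔤) [𝔥.IsCartanSubalgebra]
    (b : (CRAlg.rootSys 𝔥).Base) (φ : Set b.support)
    (hmin : CRAlg.IsMinimal (CRAlg.parabolic b φ)) :
    CRAlg.Q b φ ∩ CRAlg.conjDual 𝔥 '' CRAlg.Qneg b φ =
        (CRAlg.Qn b φ ∩ CRAlg.imaginaryRoots 𝔥) ∪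
          (CRAlg.Qr b φ ∩ CRAlg.conjDual 𝔥 '' CRAlg.Qneg b φ) ∧
      (CRAlg.IsFinitelyNondegenerate (CRAlg.parabolic b φ) →
        (CRAlg.Qn b φ ∩ CRAlg.imaginaryRoots 𝔥 = ∅ →
          CRAlg.leviOrder (CRAlg.parabolic b φ) = 1) ∧
        (CRAlg.Qn b φ ∩ CRAlg.imaginaryRoots 𝔥 ≠ ∅ →
          CRAlg.leviOrder (CRAlg.parabolic b φ) =
            ⨆ β ∈ CRAlg.Qn b φ ∩ CRAlg.imaginaryRoots 𝔥, CRAlg.kIndex b φ β)) := by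
  exact ⟨CRAlg.Q_inter_image_Qneg hmin, fun hfin =>
    ⟨CRAlg.leviOrder_eq_one hmin hfin, CRAlg.leviOrder_eq_iSup hmin hfin⟩⟩
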